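/- **Setting.** For $N\ge 1$ let $[N]=\{1,\dots,N\}$. A *randomized strong-stuck-at code* of length $N$ with $t$ random bits consists of finite message sets $\mathcal M_1,\dots,\mathcal M_N\subseteq\{0,1\}^*$, encoding maps $$E_i(\mathbf v,\mathcal F,\mathbf m;\mathbf u)\in\{0,1\}^N\cup\{\text{failure}\}\qquad(\mathbf v\in\{0,1\}^N,\ \mathcal F\subseteq[N],\ |\mathcal F|=i,\ \mathbf m\in\mathcal M_i,\ \mathbf u\in\{0,1\}^t),$$ and a deterministic decoder $D:\{0,1\}^N\to\bigcup_{i=1}^N\mathcal M_i$, such that for all $i,\mathbf v,\mathcal F,\mathbf m,\mathbf u$ as above, whenever $\mathbf w=E_i(\mathbf v,\mathcal F,\mathbf m;\mathbf u)$ is not a failure, $\mathbf w_j=\mathbf v_j$ for every $j\in\mathcal F$ and $D(\mathbf w)=\mathbf m$. (The decoder knows neither $\mathcal F$ nor $|\mathcal F|$ nor $\mathbf u$.) The encoder succeeds with probability at least $p$ if for all $i,\mathbf v,\mathcal F,\mathbf m$ as above the probability over uniformly random $\mathbf u\in\{0,1\}^t$ that $E_i(\mathbf v,\mathcal F,\mathbf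 m;\mathbf u)$ is not a failure is at least $p$. The code is *$\varepsilon$-gapped* if for every $\rho\in(0,1-\varepsilon)$ with $\rho N$ an integer, its rate $\frac1N\log_2|\mathcal M_{\rho N}|$ is at least $1-\rho-\varepsilon$. **Theorem.** There are absolute constants $c,a,b$ and a function $\delta(N)$ with $\delta(N)\to0$ as $N\to\infty$ such that the following holds. For every $\varepsilon>0$ there are two programs (an encoder and a decoder) for a random access machine with logarithmic cost, and an $N(\varepsilon)$, such that for every $N>N(\varepsilon)$ there is a randomized $\varepsilon$-gapped strong-stuck-at code of length $N$, each of whose message sets is either empty or the set of all binary strings of some length, with the following properties. 1. The first program computes the encoder (from $\mathbf v$, the indicator vector of $\mathcal F$, $\mathbf m$ and $\mathbf u$), and the second computes the decoder, each in time at most $c\,N(\log_2 N)^a(1/\varepsilon)^b$. 2. The number $t$ of random bits used by the encoder is at most $c\,\frac1\varepsilon\log_2N$, and the encoder succeeds with probability at least $1-\delta(N)$. -/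

import Mathlib

namespace StuckAt

/-! ### Randomized strong-stuck-at codes -/

/-- Binary words of length `N`. -/
abbrev Word (N : ℕ) : Type := Fin N → Bool

/-- The data of a randomized code of length `N` whose encoder uses `t` random bits.
`msgs i` is the set of messages that are available when exactly `i` positions are frozen.
The number of frozen positions is determined by the frozen set `F`, so the whole sequence of
encoding maps `E_1, …, E_N` is one function `enc`: `E_i` is its restriction to the frozen sets of
cardinality `i` and to the messages in `msgs i`. The last argument of `enc` is the string of
random bits, and the value `none` means that the encoder declares failure.
The decoder is deterministic and receives only the stored word. -/
structure RandCode (N t : ℕ) where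
  msgs : ℕ → Finset (List Bool)
  enc : Word N → Finset (Fin N) → List Bool → Word t → Option (Word N)
  dec : Word N → List Bool

namespace RandCode

variable {N t : ℕ}

/-- Consistency and unique decodability, for every number `i ∈ [N]` of frozen positions, every
cover word, every frozen set of size `i`, every message for `i`, and every random string on which
the encoder does not declare failure; moreover the decoder takes its values in
`⋃_{i ∈ [N]} msgs i`. -/
def IsStrongStuckAt (K : RandCode N t) : Prop :=
  (∀ i ∈ Finset.Icc 1 N, ∀ (v : Word N) (F : Finset (Fin N)), F.card = i →
    ∀ m ∈ K.msgs i, ∀ (u : Word t) (w : Word N), K.enc v F m u = some w →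
      (∀ j ∈ F, w j = v j) ∧ K.dec w = m) ∧
  (∀ w : Word N, ∃ i ∈ Finset.Icc 1 N, K.dec w ∈ K.msgs i)

/-- The probability, over uniformly random `u ∈ {0,1}^t`, that the encoder succeeds. -/
noncomputable def successProb (K : RandCode N t) (v : Word N) (F : Finset (Fin N))
    (m : List Bool) : ℝ :=
  ((Finset.univ.filter fun u : Word t => (K.enc v F m u).isSome = true).card : ℝ) / 2 ^ t

/-- On every admissible input the encoder succeeds with probability at least `p`. -/
def SucceedsWithProb (K : RandCode N t) (p : ℝ) : Prop :=
  ∀ i ∈ Finset.Icc 1 N, ∀ (v : Word N) (F : Finset (Fin N)), F.card = i →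
    ∀ m ∈ K.msgs i, p ≤ K.successProb v F m

/-- The rate when `i` positions are frozen (defect fraction `i / N`). -/
noncomputable def rate (K : RandCode N t) (i : ℕ) : ℝ :=
  Real.logb 2 ((K.msgs i).card : ℝ) / N

/-- For every defect fraction `ρ ∈ (0, 1 - ε)`, that is, every such `ρ` for which `ρ N` is a whole
number `i` of positions, the rate is at least `1 - ρ - ε`. -/
def IsGapped (K : RandCode N t) (ε : ℝ) : Prop :=
  ∀ ρ ∈ Set.Ioo (0 : ℝ) (1 - ε), ∀ i : ℕ, (i : ℝ) = ρ * N → 1 - ρ - ε ≤ K.rate i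

/-- Every message set is either empty or the set of all binary strings of some length. -/
def HasBinaryMessages (K : RandCode N t) : Prop :=
  ∀ i ∈ Finset.Icc 1 N, K.msgs i = ∅ ∨ ∃ k : ℕ, ∀ x : List Bool, x ∈ K.msgs i ↔ x.length = k

end RandCode

/-! ### Random access machines with logarithmic cost -/

/-- The memory of a random access machine, organised in arrays: `σ a i` is the natural number in
cell `i` of array `a`. A program mentions only finitely many arrays, by fixed names. -/
abbrev Mem : Type := ℕ → ℕ → ℕ

/-- The arithmetic operations; `sub` is truncated subtraction and the two comparisons return
`0` or `1`. -/
inductive Op where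
  | add | sub | mul | div | mod | lt | eq

def Op.eval : Op → ℕ → ℕ → ℕ
  | .add, x, y => x + y
  | .sub, x, y => x - y
  | .mul, x, y => x * y
  | .div, x, y => x / y
  | .mod, x, y => x % y
  | .lt, x, y => if x < y then 1 else 0
  | .eq, x, y => if x = y then 1 else 0

/-- Cost of one operation: linear in the bit lengths of the operands for addition, subtraction
and comparisons, and the schoolbook product of the bit lengths for the others. -/
def Op.cost : Op → ℕ → ℕ → ℕ
  | .mul, x, y => (x.size + 1) * (y.size + 1)
  | .div, x, y => (x.size + 1) * (y.size + 1)
  | .mod, x, y => (x.size + 1) * (y.size + 1)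
  | _, x, y => x.size + y.size + 1

/-- Expressions: constants, reading a cell of an array at a computed index, and operations. -/
inductive Expr where
  | lit (n : ℕ)
  | get (a : ℕ) (e : Expr)
  | op (o : Op) (e f : Expr)

def Expr.eval (σ : Mem) : Expr → ℕ
  | .lit n => n
  | .get a e => σ a (e.eval σ)
  | .op o e f => o.eval (e.eval σ) (f.eval σ)

/-- Cost of evaluating an expression. Every memory access is charged the bit lengths of the
address and of the contents. -/
def Expr.cost (σ : Mem) : Expr → ℕ
  | .lit n => n.size + 1
  | .get a e => e.cost σ + (e.eval σ).size + (σ a (e.eval σ)).size + 1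
  | .op o e f => e.cost σ + f.cost σ + o.cost (e.eval σ) (f.eval σ)

/-- Programs. `assign a e f` stores the value of `f` in cell `e` of array `a`; the value `0` of a
condition means false and all other values mean true. -/
inductive Cmd where
  | skip
  | assign (a : ℕ) (e f : Expr)
  | seq (p q : Cmd)
  | ite (e : Expr) (p q : Cmd)
  | loop (e : Expr) (p : Cmd)

/-- The memory after writing `n` into cell `i` of array `a`. -/
def Mem.write (σ : Mem) (a i n : ℕ) : Mem :=
  fun b j => if b = a ∧ j = i then n else σ b j

/-- `Exec p σ T τ`: the program `p`, started in memory `σ`, halts in memory `τ` after time `T`. -/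
inductive Exec : Cmd → Mem → ℕ → Mem → Prop where
  | skip (σ : Mem) : Exec .skip σ 1 σ
  | assign (σ : Mem) (a : ℕ) (e f : Expr) :
      Exec (.assign a e f) σ
        (e.cost σ + f.cost σ + (e.eval σ).size + (f.eval σ).size + 1)
        (Mem.write σ a (e.eval σ) (f.eval σ))
  | seq {p q : Cmd} {σ τ υ : Mem} {S T : ℕ} (hp : Exec p σ S τ) (hq : Exec q τ T υ) :
      Exec (.seq p q) σ (S + T) υ
  | ite_true {e : Expr} {p q : Cmd} {σ τ : Mem} {T : ℕ} (he : e.eval σ ≠ 0)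
      (hp : Exec p σ T τ) : Exec (.ite e p q) σ (e.cost σ + 1 + T) τ
  | ite_false {e : Expr} {p q : Cmd} {σ τ : Mem} {T : ℕ} (he : e.eval σ = 0)
      (hq : Exec q σ T τ) : Exec (.ite e p q) σ (e.cost σ + 1 + T) τ
  | loop_done {e : Expr} {p : Cmd} {σ : Mem} (he : e.eval σ = 0) :
      Exec (.loop e p) σ (e.cost σ + 1) σ
  | loop_step {e : Expr} {p : Cmd} {σ τ υ : Mem} {S T : ℕ} (he : e.eval σ ≠ 0)
      (hp : Exec p σ S τ) (hl : Exec (.loop e p) τ T υ) :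
      Exec (.loop e p) σ (e.cost σ + 1 + S + T) υ

/-- Running time and result of a program are determined by the initial memory. -/
theorem Exec.deterministic {p : Cmd} {σ τ τ' : Mem} {T T' : ℕ} (h : Exec p σ T τ)
    (h' : Exec p σ T' τ') : T = T' ∧ τ = τ' := by
  induction h generalizing T' τ' with
  | skip σ => cases h'; exact ⟨rfl, rfl⟩
  | assign σ a e f => cases h'; exact ⟨rfl, rfl⟩
  | seq hp hq ihp ihq =>
    cases h' with
    | seq hp' hq' =>
      obtain ⟨rfl, rfl⟩ := ihp hp'
      obtain ⟨rfl, rfl⟩ := ihq hq'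
      exact ⟨rfl, rfl⟩
  | ite_true he hp ih =>
    cases h' with
    | ite_true he' hp' => obtain ⟨rfl, rfl⟩ := ih hp'; exact ⟨rfl, rfl⟩
    | ite_false he' hq' => exact absurd he' he
  | ite_false he hq ih =>
    cases h' with
    | ite_true he' hp' => exact absurd he he'
    | ite_false he' hq' => obtain ⟨rfl, rfl⟩ := ih hq'; exact ⟨rfl, rfl⟩
  | loop_done he =>
    cases h' with
    | loop_done he' => exact ⟨rfl, rfl⟩
    | loop_step he' hp' hl' => exact absurd he he'
  | loop_step he hp hl ihp ihl =>
    cases h' with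
    | loop_done he' => exact absurd he' he
    | loop_step he' hp' hl' =>
      obtain ⟨rfl, rfl⟩ := ihp hp'
      obtain ⟨rfl, rfl⟩ := ihl hl'
      exact ⟨rfl, rfl⟩

/-- The initial memory on a list of input strings: the length of the `a`-th string is in cell `0`
of array `a`, and its bits are in the cells `1, 2, …`; all other cells hold `0`. -/
def load (xs : List (List Bool)) : Mem
  | a, 0 => (xs.getD a []).length
  | a, i + 1 => ((xs.getD a []).getD i false).toNat

/-- The output string, read off array `0` in the same format. -/
def output (σ : Mem) : List Bool :=
  (List.range (σ 0 0)).map fun i => decide (σ 0 (i + 1) ≠ 0)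

/-- On the input strings `xs` the program `p` halts within time `T` and outputs the string `y`. -/
def OutputsWithin (p : Cmd) (xs : List (List Bool)) (y : List Bool) (T : ℝ) : Prop :=
  ∃ (S : ℕ) (τ : Mem), Exec p (load xs) S τ ∧ (S : ℝ) ≤ T ∧ output τ = y

namespace RandCode

variable {N t : ℕ}

/-- The encoder's output as a string: the stored word, or the empty string for a failure. -/
def resultString : Option (Word N) → List Bool
  | some w => List.ofFn w
  | none => []

/-- The program `p` computes the encoder within time `T`, for every choice of the random bits
(also when the encoder fails). Its input consists of the cover word, the
indicator vector of the frozen set, the message, and the random bits. -/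
def EncoderRunsIn (K : RandCode N t) (p : Cmd) (T : ℝ) : Prop :=
  ∀ i ∈ Finset.Icc 1 N, ∀ (v : Word N) (F : Finset (Fin N)), F.card = i →
    ∀ m ∈ K.msgs i, ∀ u : Word t,
      OutputsWithin p
        [List.ofFn v, List.ofFn (fun j : Fin N => decide (j ∈ F)), m, List.ofFn u]
        (resultString (K.enc v F m u)) T

/-- The program `q` computes the decoder within time `T`. Its only input is the stored word. -/
def DecoderRunsIn (K : RandCode N t) (q : Cmd) (T : ℝ) : Prop :=
  ∀ w : Word N, OutputsWithin q [List.ofFn w] (K.dec w) T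

end RandCode

end StuckAt

/-! The word is cut into M = N / B blocks, whose length B depends only on ε. A counting argument
gives for each k a map f k from blocks to k bits that is onto on every subcube of dimension at least
k + g, with g about log B (`exists_onto_subcubes`). Hence a block with φ frozen positions can store
any B − φ − g bits, provided that the decoder knows how many. Announcing this status costs s bits
per block, again about log B, and blocks that offer fewer than κ bits are given up. All losses
together stay below 4κ per block, and B = 4Eκ makes this a share 1/E ≤ ε.

The statuses travel in the same stream as the message: M statuses in the order of visiting, the
message, and a terminating 1. The decoder must know the status of a block before it can read that
block, so the blocks read earlier must already have delivered it (`Fits.le_pre`). Every usable block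
brings at least κ bits, every block consumes s, and the total balance is nonnegative (`Fits.le_us`).
By the cycle lemma some cyclic starting point keeps all partial balances nonnegative
(`Fits.le_usVisit`). The first block stores exactly κ bits, so its own status is known in advance.

The starting block is announced by the weight of the word modulo M. When the stream is exhausted,
the remaining blocks have free positions set to zero, at least M of them (`Fits.le_spareCount`), and
turning some into ones produces any required residue (`Fits.start_encode`). Decoding then returns
the message (`Fits.decode_encode`). The encoder is deterministic and never fails, so no random bits
are needed.

The programs contain the tables of the block code as constants. The number of steps is linear in N,
each step costs O(log² N), and all constants depend only on ε; one further logarithm absorbs them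
for large N (`Params.time_le`). -/

namespace StuckAt

/-! ### Cost bounds and a program logic with step counts -/

/-- The memory with array `a` replaced by `f`. -/
def Mem.set (σ : Mem) (a : ℕ) (f : ℕ → ℕ) : Mem := fun b => if b = a then f else σ b

@[simp] theorem Mem.set_same (σ : Mem) (a : ℕ) (f : ℕ → ℕ) : σ.set a f a = f := by
  simp [Mem.set]

@[simp] theorem Mem.set_ne (σ : Mem) {a b : ℕ} (f : ℕ → ℕ) (h : b ≠ a) : σ.set a f b = σ b := by
  simp [Mem.set, h]

theorem Mem.write_eq_set (σ : Mem) (a i n : ℕ) :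
    σ.write a i n = σ.set a (Function.update (σ a) i n) := by
  funext b j
  by_cases hb : b = a
  · subst hb
    by_cases hj : j = i <;> simp [Mem.write, Mem.set, Function.update, hj]
  · simp [Mem.write, Mem.set, hb]

/-- All cells hold numbers at most `X`. -/
def Bdd (X : ℕ) (σ : Mem) : Prop := ∀ a i, σ a i ≤ X

theorem Bdd.set {X : ℕ} {σ : Mem} (h : Bdd X σ) {a : ℕ} {f : ℕ → ℕ} (hf : ∀ i, f i ≤ X) :
    Bdd X (σ.set a f) := by
  intro b i
  by_cases hb : b = a
  · subst hb; simpa using hf i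
  · simpa [hb] using h b i

section
variable (x y : ℕ)

@[simp] theorem Expr.eval_lit (σ : Mem) (n : ℕ) : (Expr.lit n).eval σ = n := rfl
@[simp] theorem Expr.eval_get (σ : Mem) (e : Expr) (a : ℕ) :
    (Expr.get a e).eval σ = σ a (e.eval σ) := rfl
@[simp] theorem Expr.eval_op (σ : Mem) (o : Op) (e f : Expr) :
    (Expr.op o e f).eval σ = o.eval (e.eval σ) (f.eval σ) := rfl
@[simp] theorem Op.eval_add : Op.add.eval x y = x + y := rfl
@[simp] theorem Op.eval_sub : Op.sub.eval x y = x - y := rfl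
@[simp] theorem Op.eval_mul : Op.mul.eval x y = x * y := rfl
@[simp] theorem Op.eval_div : Op.div.eval x y = x / y := rfl
@[simp] theorem Op.eval_mod : Op.mod.eval x y = x % y := rfl
@[simp] theorem Op.eval_lt : Op.lt.eval x y = if x < y then 1 else 0 := rfl
@[simp] theorem Op.eval_eq : Op.eq.eval x y = if x = y then 1 else 0 := rfl

end

/-- The value of an expression is at most the `deg`-th power of the memory bound. -/
def Expr.deg : Expr → ℕ
  | .lit n => n + 1
  | .get _ _ => 1
  | .op _ e f => e.deg + f.deg

/-- This is the cost in multiples of `unit X`, independent of the memory. An operation on values of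
at most `deg` times `X.size` bits costs at most the product of two such lengths. -/
def Expr.wt : Expr → ℕ
  | .lit n => n.size + 1
  | .get _ e => e.wt + e.deg + 2
  | .op _ e f => e.wt + f.wt + (e.deg + 1) * (f.deg + 1)

/-- A loop body is counted once; repetitions enter through the step count of `Tr`. -/
def Cmd.wt : Cmd → ℕ
  | .skip => 1
  | .assign _ e f => e.wt + f.wt + e.deg + f.deg + 1
  | .seq p q => p.wt + q.wt
  | .ite e p q => e.wt + 1 + p.wt + q.wt
  | .loop e p => e.wt + 1 + p.wt

theorem Expr.deg_pos (e : Expr) : 1 ≤ e.deg := by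
  induction e with
  | lit n => simp [Expr.deg]
  | get a e ih => simp [Expr.deg]
  | op o e f he hf => simp only [Expr.deg]; omega

theorem Expr.eval_le {X : ℕ} (hX : 2 ≤ X) {σ : Mem} (h : Bdd X σ) (e : Expr) :
    e.eval σ ≤ X ^ e.deg := by
  induction e with
  | lit n =>
    calc n ≤ 2 ^ n := Nat.lt_two_pow_self.le
      _ ≤ X ^ n := Nat.pow_le_pow_left hX n
      _ ≤ X ^ (n + 1) := Nat.pow_le_pow_right (by omega) (by omega)
  | get a e ih => simpa [Expr.eval, Expr.deg] using h a _
  | op o e f he hf =>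
    simp only [Expr.deg, Expr.eval]
    have h1 : 2 ≤ X ^ e.deg := hX.trans (Nat.le_self_pow (by have := e.deg_pos; omega) X)
    have h2 : 2 ≤ X ^ f.deg := hX.trans (Nat.le_self_pow (by have := f.deg_pos; omega) X)
    have h3 : X ^ e.deg + X ^ f.deg ≤ X ^ (e.deg + f.deg) := by
      rw [pow_add]; nlinarith
    have h4 : e.eval σ * f.eval σ ≤ X ^ (e.deg + f.deg) := by
      rw [pow_add]; exact Nat.mul_le_mul he hf
    cases o <;> simp only [Op.eval]
    · omega
    · omega
    · exact h4
    · exact (Nat.div_le_self _ _).trans (by omega)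
    · exact (Nat.mod_le _ _).trans (by omega)
    · split_ifs <;> omega
    · split_ifs <;> omega

theorem Expr.size_eval_le {X : ℕ} (hX : 2 ≤ X) {σ : Mem} (h : Bdd X σ) (e : Expr) :
    (e.eval σ).size ≤ e.deg * X.size := by
  rw [Nat.size_le]
  calc e.eval σ ≤ X ^ e.deg := e.eval_le hX h
    _ < (2 ^ X.size) ^ e.deg :=
      Nat.pow_lt_pow_left (Nat.lt_size_self X) (by have := e.deg_pos; omega)
    _ = 2 ^ (e.deg * X.size) := by rw [← pow_mul, mul_comm]

/-- The cost unit for memories bounded by `X`. -/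
def unit (X : ℕ) : ℕ := (X.size + 1) ^ 2

theorem one_le_unit (X : ℕ) : 1 ≤ unit X := Nat.one_le_pow _ _ (by omega)

theorem size_succ_le_unit (X : ℕ) : X.size + 1 ≤ unit X := Nat.le_self_pow (by omega) _

theorem Expr.cost_le {X : ℕ} (hX : 2 ≤ X) {σ : Mem} (h : Bdd X σ) (e : Expr) :
    e.cost σ ≤ e.wt * unit X := by
  have hu := one_le_unit X
  have hs := size_succ_le_unit X
  induction e with
  | lit n => simp only [Expr.cost, Expr.wt]; nlinarith
  | get a e ih =>
    simp only [Expr.cost, Expr.wt]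
    have h1 := e.size_eval_le hX h
    have h2 : (σ a (e.eval σ)).size ≤ X.size := Nat.size_le_size (h _ _)
    nlinarith [Nat.mul_le_mul_left e.deg hs]
  | op o e f he hf =>
    simp only [Expr.cost, Expr.wt]
    have h1 := e.size_eval_le hX h
    have h2 := f.size_eval_le hX h
    have h3 : ((e.eval σ).size + 1) * ((f.eval σ).size + 1)
        ≤ (e.deg + 1) * (f.deg + 1) * unit X := by
      calc _ ≤ ((e.deg + 1) * (X.size + 1)) * ((f.deg + 1) * (X.size + 1)) := by
            apply Nat.mul_le_mul <;> nlinarith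
        _ = _ := by unfold unit; ring
    have h4 : (e.eval σ).size + (f.eval σ).size + 1 ≤ (e.deg + 1) * (f.deg + 1) * unit X := by
      refine le_trans ?_ h3; nlinarith [Nat.zero_le ((e.eval σ).size * (f.eval σ).size)]
    have h5 : o.cost (e.eval σ) (f.eval σ) ≤ (e.deg + 1) * (f.deg + 1) * unit X := by
      cases o <;> simp only [Op.cost] <;> assumption
    nlinarith

/-- Started in `σ`, the program halts within `n` steps in a memory that satisfies `Q`, and all
numbers stay bounded by `X`. -/
def Tr (X : ℕ) (p : Cmd) (σ : Mem) (n : ℕ) (Q : Mem → Prop) : Prop :=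
  Bdd X σ → ∃ T τ, Exec p σ T τ ∧ T ≤ n * (p.wt * unit X) ∧ Bdd X τ ∧ Q τ

namespace Tr

variable {X : ℕ} {σ : Mem} {Q : Mem → Prop}

theorem mono {p : Cmd} {n n' : ℕ} {Q' : Mem → Prop} (h : Tr X p σ n Q) (hn : n ≤ n')
    (hQ : ∀ τ, Q τ → Q' τ) : Tr X p σ n' Q' := by
  intro hb
  obtain ⟨T, τ, h1, h2, h3, h4⟩ := h hb
  exact ⟨T, τ, h1, h2.trans (Nat.mul_le_mul_right _ hn), h3, hQ _ h4⟩

theorem post {p : Cmd} {n : ℕ} {Q' : Mem → Prop} (h : Tr X p σ n Q)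
    (hQ : ∀ τ, Q τ → Q' τ) : Tr X p σ n Q' := h.mono le_rfl hQ

theorem skip (h : Q σ) : Tr X .skip σ 1 Q := by
  intro hb
  refine ⟨1, σ, .skip σ, ?_, hb, h⟩
  have := one_le_unit X
  simp only [Cmd.wt]; omega

theorem assign (hX : 2 ≤ X) {a : ℕ} {e f : Expr} {i n : ℕ} (hi : e.eval σ = i)
    (hn : f.eval σ = n) (hnX : n ≤ X) (hQ : Q (σ.set a (Function.update (σ a) i n))) :
    Tr X (.assign a e f) σ 1 Q := by
  intro hb
  refine ⟨_, _, .assign σ a e f, ?_, ?_, ?_⟩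
  · have h1 := e.cost_le hX hb
    have h2 := f.cost_le hX hb
    have h3 := e.size_eval_le hX hb
    have h4 := f.size_eval_le hX hb
    have hu := one_le_unit X
    have hs := size_succ_le_unit X
    simp only [Cmd.wt]
    nlinarith [Nat.mul_le_mul_left e.deg hs, Nat.mul_le_mul_left f.deg hs]
  · rw [Mem.write_eq_set]
    refine hb.set fun j => ?_
    by_cases hj : j = e.eval σ
    · subst hj; simpa [hn] using hnX
    · simpa [Function.update, hj] using hb a j
  · rw [Mem.write_eq_set, hi, hn]; exact hQ

/-- A step is charged the weight of the whole program, so n·wt p + m·wt q ≤ (n + m)(wt p + wt q).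
The loss is a constant factor per program, and step counts simply add. -/
theorem seq {p q : Cmd} {n m : ℕ} (h : Tr X p σ n fun τ => Tr X q τ m Q) :
    Tr X (.seq p q) σ (n + m) Q := by
  intro hb
  obtain ⟨S, τ, h1, h2, h3, h4⟩ := h hb
  obtain ⟨T, υ, h5, h6, h7, h8⟩ := h4 h3
  refine ⟨_, υ, .seq h1 h5, ?_, h7, h8⟩
  simp only [Cmd.wt]
  nlinarith [Nat.zero_le (n * (q.wt * unit X)), Nat.zero_le (m * (p.wt * unit X))]

/-- A round takes one step for the test besides the body; the last summand 1 pays for the failing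
test. -/
theorem loop (hX : 2 ≤ X) {e : Expr} {p : Cmd} {m : ℕ} (n : ℕ) (I : ℕ → Mem → Prop)
    (h0 : I 0 σ) (hstep : ∀ k < n, ∀ τ, I k τ → e.eval τ ≠ 0 ∧ Tr X p τ m (I (k + 1)))
    (hend : ∀ τ, I n τ → e.eval τ = 0 ∧ Q τ) :
    Tr X (.loop e p) σ (n * (m + 1) + 1) Q := by
  have key : ∀ d k : ℕ, k + d = n → ∀ τ, I k τ → Tr X (.loop e p) τ (d * (m + 1) + 1) Q := by
    intro d
    induction d with
    | zero =>
      intro k hk τ hτ hb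
      obtain rfl : k = n := by omega
      obtain ⟨h1, h2⟩ := hend τ hτ
      refine ⟨_, τ, .loop_done h1, ?_, hb, h2⟩
      have := e.cost_le hX hb
      have hu := one_le_unit X
      simp only [Cmd.wt]
      nlinarith [Nat.zero_le (p.wt * unit X)]
    | succ d ih =>
      intro k hk τ hτ hb
      obtain ⟨h1, h2⟩ := hstep k (by omega) τ hτ
      obtain ⟨S, υ, h3, h4, h5, h6⟩ := h2 hb
      obtain ⟨T, ω, h7, h8, h9, h10⟩ := ih (k + 1) (by omega) υ h6 h5
      refine ⟨_, ω, .loop_step h1 h3 h7, ?_, h9, h10⟩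
      have := e.cost_le hX hb
      have hu := one_le_unit X
      simp only [Cmd.wt] at h8 ⊢
      nlinarith [Nat.zero_le (p.wt * unit X), Nat.zero_le (m * ((e.wt + 1) * unit X))]
  exact key n 0 (by omega) σ h0

end Tr

/-- Cell `0` of array `a`, used as a scalar variable. -/
abbrev var (a : ℕ) : Expr := .get a (.lit 0)

/-- `for c < bound do p`, with the counter in the scalar `c`. -/
def forUp (c : ℕ) (bound : Expr) (p : Cmd) : Cmd :=
  .seq (.assign c (.lit 0) (.lit 0))
    (.loop (.op .lt (var c) bound)
      (.seq p (.assign c (.lit 0) (.op .add (var c) (.lit 1)))))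

theorem Tr.forUp {X : ℕ} (hX : 2 ≤ X) {σ : Mem} {Q : Mem → Prop} {c : ℕ} {bound : Expr} {p : Cmd}
    {m : ℕ} (n : ℕ) (hn : n ≤ X) (I : ℕ → Mem → Prop)
    (h0 : I 0 (σ.set c (Function.update (σ c) 0 0)))
    (hbound : ∀ k ≤ n, ∀ τ, I k τ → bound.eval τ = n)
    (hstep : ∀ k < n, ∀ τ, I k τ → τ c 0 = k → Tr X p τ m fun υ =>
      υ c 0 = k ∧ I (k + 1) (υ.set c (Function.update (υ c) 0 (k + 1))))
    (hend : ∀ τ, I n τ → Q τ) : Tr X (forUp c bound p) σ (n * (m + 2) + 2) Q := by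
  have := Tr.loop (X := X) (Q := Q) (σ := σ.set c (Function.update (σ c) 0 0)) hX
    (e := .op .lt (var c) bound)
    (p := .seq p (.assign c (.lit 0) (.op .add (var c) (.lit 1)))) (m := m + 1) n
    (fun k τ => τ c 0 = k ∧ I k τ) (by simpa using h0)
    (by
      rintro k hk τ ⟨h1, h2⟩
      refine ⟨by simp [h1, hbound k hk.le τ h2, hk], .seq ?_⟩
      refine (hstep k hk τ h2 h1).post fun υ hυ => ?_
      refine .assign hX (i := 0) (n := k + 1) rfl (by simp [hυ.1]) (by omega) ?_
      simpa using hυ.2)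
    (by
      rintro τ ⟨h1, h2⟩
      exact ⟨by simp [h1, hbound n le_rfl τ h2], hend τ h2⟩)
  refine Tr.mono (.seq (.assign hX (i := 0) (n := 0) rfl rfl (by omega) this)) ?_ fun _ h => h
  nlinarith

/-! ### Numbers from bits, and table look-up -/

/-- The number with the binary digits `b 0, …, b (n - 1)`, least significant first. -/
def num (b : ℕ → ℕ) : ℕ → ℕ
  | 0 => 0
  | n + 1 => num b n + b n * 2 ^ n

theorem num_lt {b : ℕ → ℕ} {n : ℕ} (hb : ∀ i < n, b i < 2) : num b n < 2 ^ n := by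
  induction n with
  | zero => simp [num]
  | succ n ih =>
    have h1 := ih fun i hi => hb i (by omega)
    have h2 := hb n (by omega)
    have : b n * 2 ^ n ≤ 1 * 2 ^ n := Nat.mul_le_mul_right _ (by omega)
    rw [num, pow_succ]; omega

theorem num_digit {b : ℕ → ℕ} {n : ℕ} (hb : ∀ i < n, b i < 2) {i : ℕ} (hi : i < n) :
    num b n / 2 ^ i % 2 = b i := by
  induction n with
  | zero => omega
  | succ n ih =>
    have hb' : ∀ i < n, b i < 2 := fun i hi => hb i (by omega)
    rw [num]
    rcases Nat.lt_succ_iff_lt_or_eq.mp hi with h | rfl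
    · have : 2 ^ n = 2 ^ i * (2 * 2 ^ (n - i - 1)) := by
        rw [← pow_succ', ← pow_add]; congr 1; omega
      rw [this, show b n * (2 ^ i * (2 * 2 ^ (n - i - 1))) = 2 ^ i * (2 * (b n * 2 ^ (n - i - 1)))
        by ring, Nat.add_mul_div_left _ _ (by positivity), Nat.add_mul_mod_self_left, ih hb' h]
    · rw [Nat.add_mul_div_right _ _ (by positivity), Nat.div_eq_of_lt (num_lt hb')]
      have := hb i (by omega)
      omega

theorem num_congr {b c : ℕ → ℕ} {n : ℕ} (h : ∀ i < n, b i = c i) : num b n = num c n := by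
  induction n with
  | zero => rfl
  | succ n ih => rw [num, num, ih fun i hi => h i (by omega), h n (by omega)]

theorem num_digits (y n : ℕ) : num (fun i => y / 2 ^ i % 2) n = y % 2 ^ n := by
  induction n with
  | zero => simp [num, Nat.mod_one]
  | succ n ih => rw [num, ih, pow_succ, Nat.mod_mul]; ring

/-- The number stored in binary in `n` cells of array `a` from address `e` on. -/
def numE (a : ℕ) (e : Expr) : ℕ → Expr
  | 0 => .lit 0
  | n + 1 => .op .add (numE a e n) (.op .mul (.get a (.op .add e (.lit n))) (.lit (2 ^ n)))

theorem numE_eval (a : ℕ) (e : Expr) (n : ℕ) (σ : Mem) :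
    (numE a e n).eval σ = num (fun i => σ a (e.eval σ + i)) n := by
  induction n with
  | zero => rfl
  | succ n ih => simp [numE, num, ih]

/-- The sum of `n` cells of array `a` from address `e` on. -/
def sumE (a : ℕ) (e : Expr) : ℕ → Expr
  | 0 => .lit 0
  | n + 1 => .op .add (sumE a e n) (.get a (.op .add e (.lit n)))

theorem sumE_eval (a : ℕ) (e : Expr) (n : ℕ) (σ : Mem) :
    (sumE a e n).eval σ = ∑ i ∈ Finset.range n, σ a (e.eval σ + i) := by
  induction n with
  | zero => rfl
  | succ n ih => simp [sumE, Finset.sum_range_succ, ih]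

/-- Selection of the expression `t i` by the value `i < n` of `e`. -/
def look : ℕ → Expr → (ℕ → Expr) → Expr
  | 0, _, _ => .lit 0
  | n + 1, e, t => .op .add (look n e t) (.op .mul (.op .eq e (.lit n)) (t n))

/-- At most one indicator is nonzero. All n entries are evaluated each time, which is harmless
because the tables have constant size for fixed ε. -/
theorem look_eval (n : ℕ) (e : Expr) (t : ℕ → Expr) (σ : Mem) :
    (look n e t).eval σ = if e.eval σ < n then (t (e.eval σ)).eval σ else 0 := by
  induction n with
  | zero => rfl
  | succ n ih =>
    simp only [look, Expr.eval_op, Op.eval_add, Op.eval_mul, Op.eval_eq, Expr.eval_lit, ih]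
    rcases lt_trichotomy (e.eval σ) n with h | h | h
    · rw [if_pos h, if_neg (by omega), if_pos (by omega)]; simp
    · rw [if_neg (by omega), if_pos h, if_pos (by omega), h]; simp
    · rw [if_neg (by omega), if_neg (by omega), if_neg (by omega)]; simp

/-- Write the `n` low bits of the scalar `y` into array `a` from address `base` (a scalar) on. -/
def writeBits (a base y : ℕ) : ℕ → Cmd
  | 0 => .skip
  | n + 1 => .seq (writeBits a base y n)
      (.assign a (.op .add (var base) (.lit n))
        (.op .mod (.op .div (var y) (.lit (2 ^ n))) (.lit 2)))

/-- The array `f` with the `n` low bits of `y` written from address `b` on. -/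
def putBits (f : ℕ → ℕ) (b y n : ℕ) : ℕ → ℕ :=
  fun i => if b ≤ i ∧ i < b + n then y / 2 ^ (i - b) % 2 else f i

theorem putBits_succ (f : ℕ → ℕ) (b y n : ℕ) :
    putBits f b y (n + 1) = Function.update (putBits f b y n) (b + n) (y / 2 ^ n % 2) := by
  funext i
  by_cases h : i = b + n
  · subst h; simp [putBits]
  · rw [Function.update_of_ne h]
    unfold putBits
    by_cases h' : b ≤ i ∧ i < b + n
    · rw [if_pos h', if_pos ⟨h'.1, by omega⟩]
    · rw [if_neg h', if_neg (by omega)]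

theorem Tr.writeBits {X : ℕ} (hX : 2 ≤ X) {σ : Mem} {a base y : ℕ} (n : ℕ) {Q : Mem → Prop}
    (hb : base ≠ a) (hy : y ≠ a)
    (hQ : Q (σ.set a (putBits (σ a) (σ base 0) (σ y 0) n))) :
    Tr X (writeBits a base y n) σ (n + 1) Q := by
  -- The induction needs the exact final memory: the next assignment still reads `base` and `y`.
  suffices h : Tr X (StuckAt.writeBits a base y n) σ (n + 1)
      (fun τ => τ = σ.set a (putBits (σ a) (σ base 0) (σ y 0) n)) from
    h.post fun τ h => h ▸ hQ
  clear hQ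
  induction n with
  | zero =>
    refine .skip ?_
    funext b
    by_cases h : b = a
    · subst h
      rw [Mem.set_same]; funext i; simp only [putBits]; rw [if_neg (by omega)]
    · simp [h]
  | succ n ih =>
    refine .seq (ih.post ?_)
    rintro _ rfl
    refine .assign hX (i := σ base 0 + n) (n := σ y 0 / 2 ^ n % 2) ?_ ?_ (by omega) ?_
    · simp [hb]
    · simp [hy]
    · rw [putBits_succ]
      funext b
      by_cases h : b = a
      · subst h; simp
      · simp [h]

/-! ### Functions that are onto on every large subcube -/

/-- This is (1 − 1/q)^q ≤ 1/2 without division: for q = n + 1, Bernoulli's inequality gives (1 +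
1/n)^(n+1) ≥ 2. -/
theorem two_mul_pred_pow_le {q : ℕ} (hq : 0 < q) : 2 * (q - 1) ^ q ≤ q ^ q := by
  obtain _ | n := q
  · omega
  rcases Nat.eq_zero_or_pos n with rfl | hn
  · simp
  have h := one_add_mul_le_pow (R := ℝ) (a := 1 / n) (by have : (0 : ℝ) ≤ 1 / n := by positivity
                                                         linarith) (n + 1)
  have hn' : (0 : ℝ) < n := by exact_mod_cast hn
  have h2 : (2 : ℝ) ≤ (1 + 1 / (n : ℝ)) ^ (n + 1) := by
    refine le_trans ?_ h
    push_cast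
    have : (n : ℝ) * (1 / n) = 1 := by field_simp
    nlinarith [show (0 : ℝ) ≤ 1 / n by positivity]
  have h3 : (1 + 1 / (n : ℝ)) ^ (n + 1) * (n : ℝ) ^ (n + 1) = (n + 1 : ℝ) ^ (n + 1) := by
    rw [← mul_pow]; congr 1; field_simp
  have : (2 * (n : ℝ) ^ (n + 1)) ≤ (n + 1 : ℝ) ^ (n + 1) := by
    rw [← h3]; exact mul_le_mul_of_nonneg_right h2 (by positivity)
  simpa using (by exact_mod_cast this : 2 * n ^ (n + 1) ≤ (n + 1) ^ (n + 1))

theorem card_subcube {B : ℕ} (F : Finset (Fin B)) (V : Fin B → Bool) :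
    (Finset.univ.filter fun x : Fin B → Bool => ∀ j ∈ F, x j = V j).card = 2 ^ (B - F.card) := by
  have : (Finset.univ.filter fun x : Fin B → Bool => ∀ j ∈ F, x j = V j) =
      Fintype.piFinset fun j => if j ∈ F then {V j} else Finset.univ := by
    ext x
    simp only [Finset.mem_filter, Finset.mem_univ, true_and, Fintype.mem_piFinset]
    refine forall_congr' fun j => ?_
    by_cases h : j ∈ F <;> simp [h]
  rw [this, Fintype.card_piFinset]
  have : ∀ j, (if j ∈ F then {V j} else (Finset.univ : Finset Bool)).card =
      if j ∈ F then 1 else 2 := by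
    intro j; split_ifs <;> simp
  simp only [this, Finset.prod_ite, Finset.prod_const, one_pow, one_mul]
  congr 1
  rw [Finset.filter_not, Finset.card_sdiff]
  simp

theorem card_avoid {α β : Type*} [Fintype α] [DecidableEq α] [Fintype β] [DecidableEq β]
    (S : Finset α) (y : β) :
    (Finset.univ.filter fun f : α → β => ∀ x ∈ S, f x ≠ y).card =
      (Fintype.card β - 1) ^ S.card * Fintype.card β ^ (Fintype.card α - S.card) := by
  have : (Finset.univ.filter fun f : α → β => ∀ x ∈ S, f x ≠ y) =
      Fintype.piFinset fun x => if x ∈ S then Finset.univ.erase y else Finset.univ := by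
    ext f
    simp only [Finset.mem_filter, Finset.mem_univ, true_and, Fintype.mem_piFinset]
    refine forall_congr' fun j => ?_
    by_cases h : j ∈ S <;> simp [h]
  rw [this, Fintype.card_piFinset]
  have : ∀ j, (if j ∈ S then Finset.univ.erase y else (Finset.univ : Finset β)).card =
      if j ∈ S then Fintype.card β - 1 else Fintype.card β := by
    intro j; split_ifs <;> simp [Finset.card_univ]
  simp only [this, Finset.prod_ite, Finset.prod_const]
  congr 2
  · simp
  · rw [Finset.filter_not, Finset.card_sdiff]
    simp [Finset.card_univ]

/-- There is a `k`-bit function on the cube of dimension `B` that is onto on every subcube whose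
dimension is at least `k + g`. -/
theorem exists_onto_subcubes {B g : ℕ} (k : ℕ) (hg : 3 * B ≤ 2 ^ g) (hg0 : 0 < g) :
    ∃ f : (Fin B → Bool) → Fin (2 ^ k), ∀ (F : Finset (Fin B)) (V : Fin B → Bool) (y : Fin (2 ^ k)),
      k + g + F.card ≤ B → ∃ x, (∀ j ∈ F, x j = V j) ∧ f x = y := by
  by_cases hk : k + g ≤ B
  swap
  · exact ⟨fun _ => ⟨0, by positivity⟩, fun F V y h => absurd h (by omega)⟩
  -- Union bound by counting: if every function failed, the sets of functions that miss some value y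
  -- on some subcube (F, V) would cover all functions.
  by_contra! hcon
  set q := 2 ^ k with hq
  have hq0 : 0 < q := by positivity
  let S : Finset (Fin B) → (Fin B → Bool) → Finset (Fin B → Bool) := fun F V =>
    Finset.univ.filter fun x => ∀ j ∈ F, x j = V j
  let bad : Finset (Fin B) × (Fin B → Bool) × Fin q → Finset ((Fin B → Bool) → Fin q) := fun i =>
    if k + g + i.1.card ≤ B then Finset.univ.filter fun f => ∀ x ∈ S i.1 i.2.1, f x ≠ i.2.2 else ∅
  have hcover : (Finset.univ : Finset ((Fin B → Bool) → Fin q)) ⊆ Finset.univ.biUnion bad := by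
    intro f _
    obtain ⟨F, V, y, h, h'⟩ := hcon f
    refine Finset.mem_biUnion.mpr ⟨(F, V, y), Finset.mem_univ _, ?_⟩
    simp only [bad, if_pos h, S, Finset.mem_filter, Finset.mem_univ, true_and]
    exact h'
  -- The subcube has at least 2^(k+g) ≥ q·3B points, so a random function misses y on it with
  -- probability at most (1 − 1/q)^(3Bq) ≤ 2^(−3B).
  have hbad : ∀ i, (bad i).card * 8 ^ B ≤ q ^ 2 ^ B := by
    rintro ⟨F, V, y⟩
    by_cases h : k + g + F.card ≤ B
    swap
    · simp [bad, h]
    have hS : (S F V).card = 2 ^ (B - F.card) := card_subcube F V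
    have h1 : (bad (F, V, y)).card = (q - 1) ^ (S F V).card * q ^ (2 ^ B - (S F V).card) := by
      have := card_avoid (β := Fin q) (S F V) y
      simp only [Fintype.card_fin, Fintype.card_fun, Fintype.card_bool] at this
      simp only [bad, if_pos h, this]
    have h2 : q * (3 * B) ≤ (S F V).card := by
      rw [hS]
      calc q * (3 * B) ≤ 2 ^ k * 2 ^ g := Nat.mul_le_mul_left _ hg
        _ = 2 ^ (k + g) := (pow_add _ _ _).symm
        _ ≤ _ := Nat.pow_le_pow_right (by omega) (by omega)
    have h3 : (S F V).card ≤ 2 ^ B := by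
      rw [hS]; exact Nat.pow_le_pow_right (by omega) (by omega)
    have h4 : (q - 1) ^ (q * (3 * B)) * 8 ^ B ≤ q ^ (q * (3 * B)) := by
      rw [show (8 : ℕ) ^ B = 2 ^ (3 * B) by rw [pow_mul]; norm_num,
        pow_mul _ q (3 * B), pow_mul _ q (3 * B), ← mul_pow,
        mul_comm]
      exact Nat.pow_le_pow_left (two_mul_pred_pow_le hq0) _
    obtain ⟨d, hd⟩ := Nat.exists_eq_add_of_le h2
    rw [h1]
    calc (q - 1) ^ (S F V).card * q ^ (2 ^ B - (S F V).card) * 8 ^ B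
        = ((q - 1) ^ (q * (3 * B)) * 8 ^ B) * (q - 1) ^ d * q ^ (2 ^ B - (S F V).card) := by
          rw [hd, pow_add]; ring
      _ ≤ q ^ (q * (3 * B)) * q ^ d * q ^ (2 ^ B - (S F V).card) := by
          gcongr; omega
      _ = q ^ 2 ^ B := by
          rw [← pow_add, ← pow_add, ← hd]; congr 1; omega
  have htot : q ^ 2 ^ B * 8 ^ B ≤ (2 ^ B * (2 ^ B * q)) * q ^ 2 ^ B := by
    have h1 := (Finset.card_le_card hcover).trans Finset.card_biUnion_le
    simp only [Finset.card_univ, Fintype.card_fun, Fintype.card_fin, Fintype.card_bool] at h1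
    calc q ^ 2 ^ B * 8 ^ B ≤ (∑ i, (bad i).card) * 8 ^ B := Nat.mul_le_mul_right _ h1
      _ = ∑ i, (bad i).card * 8 ^ B := Finset.sum_mul _ _ _
      _ ≤ ∑ _i : Finset (Fin B) × (Fin B → Bool) × Fin q, q ^ 2 ^ B :=
          Finset.sum_le_sum fun i _ => hbad i
      _ = _ := by simp [Finset.card_univ]
  -- Since g > 0, k < B and q < 2^B, so there are fewer than 8^B triples (F, V, y).
  have hlt : 2 ^ B * (2 ^ B * q) < 8 ^ B := by
    have : (8 : ℕ) ^ B = 2 ^ B * (2 ^ B * 2 ^ B) := by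
      rw [show (8 : ℕ) = 2 * (2 * 2) by norm_num, mul_pow, mul_pow]
    rw [this]
    have : q < 2 ^ B := Nat.pow_lt_pow_right (by omega) (by omega)
    gcongr
  have hpos : 0 < q ^ 2 ^ B := by positivity
  nlinarith

/-- The tables of the code: `f k` maps blocks of `B` bits, given as numbers, to `k` bits, and
`inv k F V Y` is a block that agrees with `V` on the positions marked in `F`, and encodes the
`k` low bits of `Y` if there are at least `k + g` other positions. -/
theorem exists_tables {B g : ℕ} (hg : 3 * B ≤ 2 ^ g) (hg0 : 0 < g) :
    ∃ (f : ℕ → ℕ → ℕ) (inv : ℕ → ℕ → ℕ → ℕ → ℕ), (∀ k X, f k X < 2 ^ k) ∧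
      ∀ k Y (φ v : ℕ → ℕ), (∀ p, φ p < 2) → (∀ p, v p < 2) →
        inv k (num φ B) (num v B) Y < 2 ^ B ∧
        (∀ p < B, φ p = 1 → inv k (num φ B) (num v B) Y / 2 ^ p % 2 = v p) ∧
        (k = 0 → ∀ p < B, φ p = 0 → inv k (num φ B) (num v B) Y / 2 ^ p % 2 = 0) ∧
        (k + g + ∑ p ∈ Finset.range B, φ p ≤ B →
          f k (inv k (num φ B) (num v B) Y) = Y % 2 ^ k) := by
  choose F hF using fun k => exists_onto_subcubes (B := B) k hg hg0
  let f : ℕ → ℕ → ℕ := fun k X => (F k fun p => decide (X / 2 ^ (p : ℕ) % 2 = 1)).val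
  have hf : ∀ k X, f k X < 2 ^ k := fun k X => (F k _).isLt
  have key : ∀ k W V Y : ℕ, ∃ X < 2 ^ B,
      (∀ p < B, W / 2 ^ p % 2 = 1 → X / 2 ^ p % 2 = V / 2 ^ p % 2) ∧
      (k = 0 → ∀ p < B, W / 2 ^ p % 2 = 0 → X / 2 ^ p % 2 = 0) ∧
      (k + g + ∑ p ∈ Finset.range B, W / 2 ^ p % 2 ≤ B → f k X = Y % 2 ^ k) := by
    intro k W V Y
    -- In the other case the frozen bits are copied and all others set to zero. For k = 0 this still
    -- satisfies the last clause, because f 0 takes only the value 0.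
    by_cases hk : k ≠ 0 ∧ k + g + ∑ p ∈ Finset.range B, W / 2 ^ p % 2 ≤ B
    · obtain ⟨x, hx1, hx2⟩ := hF k (Finset.univ.filter fun p : Fin B => W / 2 ^ (p : ℕ) % 2 = 1)
        (fun p => decide (V / 2 ^ (p : ℕ) % 2 = 1)) ⟨Y % 2 ^ k, Nat.mod_lt _ (by positivity)⟩ (by
          refine le_trans (le_of_eq ?_) hk.2
          rw [Finset.card_filter, ← Fin.sum_univ_eq_sum_range (fun p => W / 2 ^ p % 2)]
          congr 1
          refine Finset.sum_congr rfl fun p _ => ?_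
          have := Nat.mod_two_eq_zero_or_one (W / 2 ^ (p : ℕ))
          split_ifs <;> omega)
      let b : ℕ → ℕ := fun p => if h : p < B then (x ⟨p, h⟩).toNat else 0
      have hb : ∀ p < B, b p < 2 := by
        intro p hp; simp only [b, dif_pos hp]; exact Bool.toNat_lt _
      have hd : ∀ p (hp : p < B), num b B / 2 ^ p % 2 = (x ⟨p, hp⟩).toNat := by
        intro p hp; rw [num_digit hb hp]; simp [b, hp]
      refine ⟨num b B, num_lt hb, ?_, fun h => absurd h hk.1, fun _ => ?_⟩
      · intro p hp hW
        rw [hd p hp, hx1 ⟨p, hp⟩ (by simpa using hW)]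
        have := Nat.mod_two_eq_zero_or_one (V / 2 ^ p)
        rcases this with h | h <;> simp [h]
      · have : (fun p : Fin B => decide (num b B / 2 ^ (p : ℕ) % 2 = 1)) = x := by
          funext p
          rw [hd p p.isLt]
          cases x p <;> simp
        simp only [f, this, hx2]
    · refine ⟨num (fun p => if W / 2 ^ p % 2 = 1 then V / 2 ^ p % 2 else 0) B, ?_, ?_, ?_, ?_⟩
      · exact num_lt fun i _ => by split_ifs <;> omega
      · intro p hp hW
        rw [num_digit (fun i _ => by split_ifs <;> omega) hp, if_pos hW]
      · intro _ p hp hW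
        rw [num_digit (fun i _ => by split_ifs <;> omega) hp, if_neg (by omega)]
      · intro h
        have : k = 0 := by tauto
        subst this
        have := hf 0 (num (fun p => if W / 2 ^ p % 2 = 1 then V / 2 ^ p % 2 else 0) B)
        rw [pow_zero, Nat.mod_one]; omega
  choose inv h1 h2 h3 h4 using key
  refine ⟨f, inv, hf, fun k Y φ v hφ hv => ⟨h1 _ _ _ _, ?_, ?_, ?_⟩⟩
  · intro p hp h
    rw [h2 _ _ _ _ p hp (by rw [num_digit (fun i _ => hφ i) hp, h]),
      num_digit (fun i _ => hv i) hp]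
  · intro hk p hp h
    exact h3 _ _ _ _ hk p hp (by rw [num_digit (fun i _ => hφ i) hp, h])
  · intro h
    refine h4 _ _ _ _ (le_trans (le_of_eq ?_) h)
    congr 1
    exact Finset.sum_congr rfl fun p hp =>
      num_digit (fun i _ => hφ i) (Finset.mem_range.mp hp)

/-! ### The code: parameters and decoder -/

/-- The constants of the code for `ε ≥ 1 / E`: block length `B`, threshold `κ`, number `s` of
status bits, and loss `g` per block, with the tables of the block code. -/
structure Params where
  E : ℕ
  B : ℕ
  κ : ℕ
  s : ℕ
  g : ℕ
  f : ℕ → ℕ → ℕ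
  inv : ℕ → ℕ → ℕ → ℕ → ℕ
  two_le_E : 2 ≤ E
  B_eq : B = 4 * E * κ
  le_κ : 4 * E * s ≤ κ
  lt_s : B < 2 ^ s
  g_eq : g = s + 2
  f_lt : ∀ k X, f k X < 2 ^ k
  inv_spec : ∀ k Y (φ v : ℕ → ℕ), (∀ p, φ p < 2) → (∀ p, v p < 2) →
    inv k (num φ B) (num v B) Y < 2 ^ B ∧
    (∀ p < B, φ p = 1 → inv k (num φ B) (num v B) Y / 2 ^ p % 2 = v p) ∧
    (k = 0 → ∀ p < B, φ p = 0 → inv k (num φ B) (num v B) Y / 2 ^ p % 2 = 0) ∧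
    (k + g + ∑ p ∈ Finset.range B, φ p ≤ B → f k (inv k (num φ B) (num v B) Y) = Y % 2 ^ k)

/-- The requirements are circular: κ must exceed 4Es, while s must suffice to write numbers up to B
= 4Eκ. With κ = 2^r the length s grows only linearly in r, so a large r works. -/
theorem exists_params {E : ℕ} (hE : 2 ≤ E) : ∃ P : Params, P.E = E ∧ 0 < P.s := by
  obtain ⟨r, hr⟩ : ∃ r : ℕ, 4 * E * ((4 * E).size + r) ≤ 2 ^ r := by
    have h1 : ∀ r : ℕ, r * r ≤ 8 * 2 ^ r := by
      intro r
      induction r with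
      | zero => simp
      | succ r ih =>
        rcases le_or_gt r 2 with h | h
        · interval_cases r <;> norm_num
        · rw [pow_succ]; nlinarith
    set D := 4 * E * ((4 * E).size + 1)
    -- For r = 8D + 1 the bound r² ≤ 8·2^r gives D·r ≤ 2^r.
    refine ⟨8 * D + 1, ?_⟩
    have := h1 (8 * D + 1)
    have h2 : 4 * E * ((4 * E).size + (8 * D + 1)) ≤ D * (8 * D + 1) := by
      simp only [D]; nlinarith [Nat.zero_le (E * (4 * E).size), Nat.zero_le (E * D)]
    nlinarith
  set κ := 2 ^ r
  have hs : (4 * E * κ).size ≤ (4 * E).size + r := by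
    rw [Nat.size_le, pow_add]
    exact Nat.mul_lt_mul_of_pos_right (Nat.lt_size_self _) (by positivity)
  have hlt := Nat.lt_size_self (4 * E * κ)
  obtain ⟨f, inv, hf, hinv⟩ := exists_tables (B := 4 * E * κ) (g := (4 * E * κ).size + 2)
    (by rw [pow_add]; omega) (by omega)
  refine ⟨⟨E, 4 * E * κ, κ, (4 * E * κ).size, _, f, inv, hE, rfl,
    (Nat.mul_le_mul_left _ hs).trans hr, hlt, rfl, hf, hinv⟩, rfl, ?_⟩
  rw [Nat.size_pos]
  have : 0 < κ := by positivity
  positivity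

namespace Params

variable (P : Params)

/-- The number in the `j`-th block of the array `w`, whose bits start in cell `1`. -/
def blk (w : ℕ → ℕ) (j : ℕ) : ℕ := num (fun p => w (j * P.B + 1 + p)) P.B

/-- The stream of decoded bits and its length after `x` blocks of `M`, starting with block `j₀`.
The first `s` bits are fixed. The bits `s x, …, s (x + 1) - 1` give the number of bits stored in the
`x`-th visited block. -/
def stream (w : ℕ → ℕ) (M j₀ : ℕ) : ℕ → (ℕ → ℕ) × ℕ
  | 0 => (putBits 0 0 P.κ P.s, P.s)
  | x + 1 =>
    let S := (stream w M j₀ x).1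
    let e := (stream w M j₀ x).2
    let k := num (fun i => S (P.s * x + i)) P.s
    (putBits S e (if k < P.B + 1 then P.f k (P.blk w ((j₀ + x) % M)) else 0) P.B, e + k)

/-- One more than the position of the last nonzero entry below `n`. -/
def lastOne (S : ℕ → ℕ) : ℕ → ℕ
  | 0 => 0
  | n + 1 => if S n = 0 then lastOne S n else n + 1

theorem lastOne_le (S : ℕ → ℕ) (n : ℕ) : lastOne S n ≤ n := by
  induction n with
  | zero => simp [lastOne]
  | succ n ih => rw [lastOne]; split_ifs <;> omega

theorem lastOne_eq {S : ℕ → ℕ} {t n : ℕ} (ht : S t ≠ 0) (htn : t < n)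
    (h : ∀ i, t < i → i < n → S i = 0) : lastOne S n = t + 1 := by
  induction n with
  | zero => omega
  | succ n ih =>
    rw [lastOne]
    rcases Nat.lt_succ_iff_lt_or_eq.mp htn with h' | rfl
    · rw [if_pos (h n h' (by omega)), ih h' fun i h1 h2 => h i h1 (by omega)]
    · rw [if_neg ht]

/-- The block where decoding starts. -/
def start (w : ℕ → ℕ) (N : ℕ) : ℕ := (∑ p ∈ Finset.range N, w (p + 1)) % (N / P.B)

def decStream (w : ℕ → ℕ) (N : ℕ) : (ℕ → ℕ) × ℕ := P.stream w (N / P.B) (P.start w N) (N / P.B)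

/-- The decoded length. -/
def decLen (w : ℕ → ℕ) (N : ℕ) : ℕ :=
  let K := lastOne (P.decStream w N).1 (P.decStream w N).2 - 1 - P.s * (N / P.B)
  if K < N - N / P.E then K else 0

/-- The decoder, as a function. -/
def decode (w : ℕ → ℕ) (N : ℕ) : List Bool :=
  (List.range (P.decLen w N)).map fun i => decide ((P.decStream w N).1 (P.s * (N / P.B) + i) ≠ 0)

theorem stream_lt (w : ℕ → ℕ) (M j₀ x i : ℕ) : (P.stream w M j₀ x).1 i < 2 := by
  induction x with
  | zero => simp only [stream, putBits]; (split_ifs <;> simp); omega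
  | succ x ih => simp only [stream, putBits]; split_ifs <;> first | exact ih | omega

/-- The decoder runs on arbitrary words, where a status may exceed B; only its length of s bits
bounds it. -/
theorem stream_len_le (w : ℕ → ℕ) (M j₀ x : ℕ) :
    (P.stream w M j₀ x).2 ≤ P.s + x * 2 ^ P.s := by
  induction x with
  | zero => simp [stream]
  | succ x ih =>
    simp only [stream]
    have : num (fun i => (P.stream w M j₀ x).1 (P.s * x + i)) P.s < 2 ^ P.s :=
      num_lt fun i _ => P.stream_lt w M j₀ x _
    rw [Nat.succ_mul]; omega

/-! ### The decoder as a program -/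

/-- The number of blocks. -/
abbrev blocksE : Expr := .op .div (var 0) (.lit P.B)

/-- Add the `N` bits of the word to the scalar `r`. -/
def sumLoop (r : ℕ) : Cmd :=
  forUp 4 (var 0) (.assign r (.lit 0) (.op .add (var r) (.get 0 (.op .add (var 4) (.lit 1)))))

/-- Cyclic increment of the block number in the scalar `5`. -/
def nextBlock : Cmd :=
  .assign 5 (.lit 0) (.op .mod (.op .add (var 5) (.lit 1)) P.blocksE)

/-- Array 7 holds the stream, scalar 8 its length, 5 the current block, 10 its status, 9 the value
to be written, and 4 the loop counter. -/
def decInit : Cmd :=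
  .seq (.assign 9 (.lit 0) (.lit P.κ)) <|
  .seq (writeBits 7 8 9 P.s) <|
  .seq (.assign 8 (.lit 0) (.lit P.s)) <|
  .assign 5 (.lit 0) (.op .mod (var 5) P.blocksE)

def decBody : Cmd :=
  .seq (.assign 10 (.lit 0) (numE 7 (.op .mul (.lit P.s) (var 4)) P.s)) <|
  .seq (.assign 9 (.lit 0) (look (P.B + 1) (var 10) fun k =>
    look (2 ^ P.B) (numE 0 (.op .add (.op .mul (var 5) (.lit P.B)) (.lit 1)) P.B) fun Y =>
      .lit (P.f k Y))) <|
  .seq (writeBits 7 8 9 P.B) <|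
  .seq (.assign 8 (.lit 0) (.op .add (var 8) (var 10)))
  P.nextBlock

def lastOneLoop : Cmd :=
  forUp 4 (var 8) (.assign 11 (.lit 0)
    (.op .add (.op .mul (.op .eq (.get 7 (var 4)) (.lit 0)) (var 11))
      (.op .mul (.op .lt (.lit 0) (.get 7 (var 4))) (.op .add (var 4) (.lit 1)))))

/-- The output overwrites array 0, but its cell 0 is replaced last: until then it holds N, from
which `blocksE` is computed. -/
def decFinish : Cmd :=
  .seq (.assign 11 (.lit 0) (.op .sub (.op .sub (var 11) (.lit 1))
    (.op .mul (.lit P.s) P.blocksE))) <|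
  .seq (.assign 11 (.lit 0) (.op .mul (var 11)
    (.op .lt (var 11) (.op .sub (var 0) (.op .div (var 0) (.lit P.E)))))) <|
  .seq (forUp 4 (var 11) (.assign 0 (.op .add (var 4) (.lit 1))
    (.get 7 (.op .add (.op .mul (.lit P.s) P.blocksE) (var 4)))))
  (.assign 0 (.lit 0) (var 11))

/-- The decoder. -/
def decoder : Cmd :=
  .seq (sumLoop 5) <| .seq P.decInit <| .seq (forUp 4 P.blocksE P.decBody) <|
  .seq lastOneLoop P.decFinish

variable {P} {X : ℕ} {σ : Mem} {Q : Mem → Prop} {N : ℕ}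

/-! ### Verification of the decoder program. -/

theorem Tr_sumLoop (hX : 2 ≤ X) (r : ℕ) (hr0 : r ≠ 0) (hr4 : r ≠ 4) (hN : σ 0 0 = N)
    (hNX : N ≤ X) (hr : σ r 0 = 0) (hw : ∀ p, σ 0 (p + 1) < 2)
    (hQ : ∀ τ : Mem, τ r 0 = ∑ p ∈ Finset.range N, σ 0 (p + 1) →
      (∀ a, a ≠ 4 → a ≠ r → τ a = σ a) → Q τ) :
    Tr X (sumLoop r) σ (N * 3 + 2) Q := by
  refine Tr.forUp hX (m := 1) N hNX
    (fun k τ => τ r 0 = ∑ p ∈ Finset.range k, σ 0 (p + 1) ∧ ∀ a, a ≠ 4 → a ≠ r → τ a = σ a)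
    ?_ ?_ ?_ ?_
  · refine ⟨by simp [hr4, hr], fun a h4 h => by simp [h4]⟩
  · rintro k - τ ⟨-, h⟩
    simp [h 0 (by omega) hr0.symm, hN]
  · rintro k hk τ ⟨h1, h2⟩ h4
    refine .assign hX (i := 0) (n := ∑ p ∈ Finset.range (k + 1), σ 0 (p + 1)) (by simp) ?_ ?_ ?_
    · simp [h1, h4, h2 0 (by omega) hr0.symm, Finset.sum_range_succ]
    · calc ∑ p ∈ Finset.range (k + 1), σ 0 (p + 1) ≤ ∑ p ∈ Finset.range (k + 1), 1 :=
            Finset.sum_le_sum fun p _ => by have := hw p; omega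
        _ ≤ X := by simp; omega
    · refine ⟨by simp [hr4.symm, h4], by simp [hr4], fun a ha har => ?_⟩
      simp [ha, har, h2 a ha har]
  · rintro τ ⟨h1, h2⟩
    exact hQ τ h1 h2

end Params

namespace Params

variable {P : Params} {X : ℕ} {σ : Mem} {Q : Mem → Prop} {N : ℕ}

/-- A bound on all numbers in the memory. -/
def bound (P : Params) (N : ℕ) : ℕ := (N + 2) * 2 ^ (P.B + P.s)

theorem bound_facts (hX : P.bound N ≤ X) :
    2 ≤ X ∧ N + 2 ≤ X ∧ 2 ^ P.B ≤ X ∧ 2 ^ P.s ≤ X ∧ P.s + (N / P.B + 1) * 2 ^ P.s ≤ X := by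
  unfold bound at hX
  have h1 : 1 ≤ 2 ^ P.B := Nat.one_le_two_pow
  have h2 : 1 ≤ 2 ^ P.s := Nat.one_le_two_pow
  have h3 : P.s < 2 ^ P.s := Nat.lt_two_pow_self
  have h4 : N / P.B ≤ N := Nat.div_le_self _ _
  rw [pow_add] at hX
  have h5 : (N + 2) * 2 ^ P.s ≤ (N + 2) * (2 ^ P.B * 2 ^ P.s) := by
    gcongr; nlinarith
  have h6 : (N + 2) * 2 ^ P.B ≤ (N + 2) * (2 ^ P.B * 2 ^ P.s) := by
    gcongr; nlinarith
  have h7 : (N / P.B + 1) * 2 ^ P.s ≤ (N + 1) * 2 ^ P.s := by gcongr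
  refine ⟨?_, ?_, ?_, ?_, ?_⟩ <;> nlinarith

theorem Tr_decMain (hX : P.bound N ≤ X) (hN : σ 0 0 = N) (h7 : σ 7 = fun _ => 0) (h8 : σ 8 0 = 0)
    (h5 : σ 5 0 = ∑ p ∈ Finset.range N, σ 0 (p + 1)) (hw : ∀ p, σ 0 (p + 1) < 2)
    (hM : 0 < N / P.B)
    (hQ : ∀ τ : Mem, τ 0 = σ 0 → τ 7 = (P.decStream (σ 0) N).1 → τ 8 0 = (P.decStream (σ 0) N).2 →
      τ 11 = σ 11 → Q τ) :
    Tr X (.seq P.decInit (forUp 4 P.blocksE P.decBody)) σ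
      (P.s + 4 + (N / P.B * (P.B + 5 + 2) + 2)) Q := by
  obtain ⟨hX2, hXN, hXB, hXs, hXe⟩ := bound_facts hX
  have hκB : P.κ ≤ P.B := by
    rw [P.B_eq]; have := P.two_le_E; nlinarith [Nat.zero_le P.κ]
  have hBs := P.lt_s
  have hj : P.start (σ 0) N < N / P.B := Nat.mod_lt _ hM
  refine .seq (.mono (.seq (.assign hX2 (i := 0) (n := P.κ) rfl rfl (by omega)
    (.seq (.writeBits hX2 P.s (by omega) (by omega)
    (.seq (.assign hX2 (i := 0) (n := P.s) rfl rfl (by have := Nat.lt_two_pow_self (n := P.s); omega)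
    (.assign hX2 (i := 0) (n := P.start (σ 0) N) rfl ?_ ?_ ?_)))))))
      (show 1 + ((P.s + 1) + (1 + 1)) ≤ P.s + 4 by omega) fun _ h => h)
  · simp [h5, hN, start]
  · have := Nat.div_le_self N P.B; omega
  refine Tr.forUp hX2 (N / P.B) (by have := Nat.div_le_self N P.B; omega)
    (fun x τ => τ 0 = σ 0 ∧ τ 7 = (P.stream (σ 0) (N / P.B) (P.start (σ 0) N) x).1 ∧
      τ 8 0 = (P.stream (σ 0) (N / P.B) (P.start (σ 0) N) x).2 ∧
      τ 5 0 = (P.start (σ 0) N + x) % (N / P.B) ∧ τ 11 = σ 11) ?_ ?_ ?_ ?_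
  · simp [h7, h8, stream, Nat.mod_eq_of_lt hj]
    rfl
  · rintro k - τ ⟨h, -⟩
    simp [h, hN]
  · rintro x hx τ ⟨g0, g7, g8, g5, g11⟩ g4
    set S := (P.stream (σ 0) (N / P.B) (P.start (σ 0) N) x).1 with hS
    set e := (P.stream (σ 0) (N / P.B) (P.start (σ 0) N) x).2 with he
    set k := num (fun i => S (P.s * x + i)) P.s with hk
    set j := (P.start (σ 0) N + x) % (N / P.B) with hjdef
    have hk2 : k < 2 ^ P.s := num_lt fun i _ => P.stream_lt _ _ _ _ _
    have hblk : P.blk (σ 0) j < 2 ^ P.B := num_lt fun i _ => by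
      rw [show j * P.B + 1 + i = j * P.B + i + 1 by ring]; exact hw _
    have hy : (if k < P.B + 1 then P.f k (P.blk (σ 0) j) else 0) ≤ 2 ^ P.B := by
      split_ifs with h
      · exact (P.f_lt _ _).le.trans (Nat.pow_le_pow_right (by omega) (by omega))
      · omega
    have he2 : e ≤ P.s + x * 2 ^ P.s := P.stream_len_le _ _ _ _
    have hek : e + k ≤ X := by
      have : (x + 1) * 2 ^ P.s ≤ (N / P.B + 1) * 2 ^ P.s := Nat.mul_le_mul_right _ (by omega)
      rw [Nat.succ_mul] at this; omega
    refine .mono (.seq (.assign hX2 (i := 0) (n := k) rfl ?_ (by omega)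
      (.seq (.assign hX2 (i := 0)
        (n := if k < P.B + 1 then P.f k (P.blk (σ 0) j) else 0) rfl ?_ (by omega)
      (.seq (.writeBits hX2 P.B (by omega) (by omega)
      (.seq (.assign hX2 (i := 0) (n := e + k) rfl ?_ hek
      (.assign hX2 (i := 0) (n := (P.start (σ 0) N + (x + 1)) % (N / P.B)) rfl ?_ ?_ ?_)))))))))
      (show 1 + (1 + ((P.B + 1) + (1 + 1))) ≤ P.B + 5 by omega) fun _ h => h
    · simp [numE_eval, g4, g7, hk]
    · simp only [look_eval, numE_eval]
      simp [g0, g5]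
      simp only [← blk.eq_1, if_pos hblk]
    · simp [g8]
    · simp [g5, g0, hN, hjdef, add_assoc]
    · exact (Nat.mod_lt _ hM).le.trans (by have := Nat.div_le_self N P.B; omega)
    · simp [g4, g0, g7, g8, g11, stream, ← hS, ← he, ← hk, ← hjdef]
  · rintro τ ⟨g0, g7, g8, -, g11⟩
    exact hQ τ g0 g7 g8 g11

theorem Tr_lastOneLoop (hX2 : 2 ≤ X) {e : ℕ} (h8 : σ 8 0 = e) (he : e ≤ X) (h11 : σ 11 0 = 0)
    (hQ : ∀ τ : Mem, τ 0 = σ 0 → τ 7 = σ 7 → τ 11 0 = lastOne (σ 7) e → Q τ) :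
    Tr X lastOneLoop σ (e * 3 + 2) Q := by
  refine Tr.forUp hX2 (m := 1) e he
    (fun x τ => τ 0 = σ 0 ∧ τ 7 = σ 7 ∧ τ 8 = σ 8 ∧ τ 11 0 = lastOne (σ 7) x) ?_ ?_ ?_ ?_
  · simp [h11, lastOne]
  · rintro k - τ ⟨-, -, h, -⟩
    simp [h, h8]
  · rintro x hx τ ⟨g0, g7, g8, g11⟩ g4
    refine .assign hX2 (i := 0) (n := lastOne (σ 7) (x + 1)) rfl ?_
      ((lastOne_le _ _).trans (by omega)) ?_
    · simp only [lastOne]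
      by_cases h : σ 7 x = 0
      · simp [g4, g7, g11, h]
      · simp [g4, g7, h, Nat.pos_of_ne_zero h]
    · simp [g0, g7, g8, g4]
  · rintro τ ⟨g0, g7, -, g11⟩
    exact hQ τ g0 g7 g11

theorem Tr_decFinish (hX2 : 2 ≤ X) (hNX : N ≤ X) (hN : σ 0 0 = N) {z : ℕ} (h11 : σ 11 0 = z)
    (h7 : ∀ i, σ 7 i < 2) (hz : z ≤ X)
    (hQ : ∀ τ : Mem, output τ = (List.range (if z - 1 - P.s * (N / P.B) < N - N / P.E then
      z - 1 - P.s * (N / P.B) else 0)).map (fun i => decide (σ 7 (P.s * (N / P.B) + i) ≠ 0)) →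
      Q τ) :
    Tr X P.decFinish σ (N * 3 + 5) Q := by
  set K := if z - 1 - P.s * (N / P.B) < N - N / P.E then z - 1 - P.s * (N / P.B) else 0 with hK
  have hKN : K ≤ N := by
    rw [hK]
    split_ifs with h
    · exact h.le.trans (Nat.sub_le _ _)
    · omega
  have hKX : K ≤ X := by omega
  refine .mono (.seq (.assign hX2 (i := 0) (n := z - 1 - P.s * (N / P.B)) rfl ?_ (by omega)
    (.seq (.assign hX2 (i := 0) (n := K) rfl ?_ hKX
    (.seq (.forUp hX2 (m := 1) K hKX
      (fun x τ => τ 0 0 = N ∧ τ 7 = σ 7 ∧ τ 11 0 = K ∧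
        ∀ i < x, τ 0 (i + 1) = σ 7 (P.s * (N / P.B) + i)) ?_ ?_ ?_
      fun τ hτ => .assign hX2 (i := 0) (n := K) rfl ?_ hKX ?_))))))
      (show 1 + (1 + (K * 3 + 2 + 1)) ≤ N * 3 + 5 by omega) fun _ h => h
  · simp [h11, hN]
  · simp [hN, hK]
  · simp [hN]
  · rintro x - τ ⟨-, -, h, -⟩
    simp [h]
  · rintro x hx τ ⟨g0, g7, g11, gi⟩ g4
    refine .assign hX2 (i := x + 1) (n := σ 7 (P.s * (N / P.B) + x)) (by simp [g4])
      (by simp [g4, g0, g7]) ((h7 _).le.trans hX2) ?_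
    refine ⟨by simp [g4], by simp [g0], by simp [g7], by simp [g11], fun i hi => ?_⟩
    rcases Nat.lt_succ_iff_lt_or_eq.mp hi with h | rfl
    · have : i + 1 ≠ x + 1 := by omega
      simp [Function.update_of_ne this, gi i h]
    · simp
  · simp [hτ.2.2.1]
  · refine hQ _ ?_
    unfold output
    simp only [Mem.set_same, Function.update_self]
    refine List.map_congr_left fun i hi => ?_
    rw [Function.update_of_ne (by omega), hτ.2.2.2 i (by simpa using hi)]

/-- The number of steps of the decoder. -/
def decSteps (P : Params) (N : ℕ) : ℕ :=
  N * (P.B + 13) + 3 * (P.s + N * 2 ^ P.s) + P.s + 20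

theorem Tr_decoder (hX : P.bound N ≤ X) (hN : σ 0 0 = N) (hσ : ∀ a, a ≠ 0 → σ a = fun _ => 0)
    (hw : ∀ p, σ 0 (p + 1) < 2) (hM : 0 < N / P.B) :
    Tr X P.decoder σ (P.decSteps N) fun τ => output τ = P.decode (σ 0) N := by
  obtain ⟨hX2, hXN, hXB, hXs, hXe⟩ := bound_facts hX
  have he : (P.decStream (σ 0) N).2 ≤ P.s + N / P.B * 2 ^ P.s := P.stream_len_le _ _ _ _
  have hMN := Nat.div_le_self N P.B
  have he2 : N / P.B * 2 ^ P.s ≤ N * 2 ^ P.s := Nat.mul_le_mul_right _ hMN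
  have he3 : N / P.B * (P.B + 5 + 2) ≤ N * (P.B + 7) := Nat.mul_le_mul_right _ hMN
  rw [Nat.succ_mul] at hXe
  have heX : (P.decStream (σ 0) N).2 ≤ X := by linarith [Nat.zero_le (2 ^ P.s)]
  -- `decoder` nests its sequence to the right, whereas `Tr_decMain` treats two commands as one.
  -- Regrouping changes neither the time nor the weight.
  have reassoc : ∀ {p q r : Cmd} {σ : Mem} {n : ℕ} {Q : Mem → Prop},
      Tr X (.seq (.seq p q) r) σ n Q → Tr X (.seq p (.seq q r)) σ n Q := by
    intro p q r σ n Q h hb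
    obtain ⟨T, τ, h1, h2, h3⟩ := h hb
    cases h1 with
    | seq h1 h4 =>
      cases h1 with
      | seq h1 h5 =>
        refine ⟨_, τ, .seq h1 (.seq h5 h4), ?_, h3⟩
        simp only [Cmd.wt] at h2 ⊢
        rw [← add_assoc, ← add_assoc]; exact h2
  refine .mono (.seq (Tr_sumLoop hX2 5 (by omega) (by omega) hN (by omega) (by simp [hσ]) hw
    fun τ h5 hτ => reassoc (.seq (Tr_decMain hX (by simp [hτ, hN]) (by simp [hτ, hσ])
      (by simp [hτ, hσ]) (by simp [hτ, h5]) (by simpa [hτ] using hw) hM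
    fun υ g0 g7 g8 g11 => .seq (Tr_lastOneLoop hX2 (e := (P.decStream (σ 0) N).2)
      (g8.trans (by rw [hτ 0 (by omega) (by omega)])) heX
      (by simp [g11, hτ, hσ])
    fun ω k0 k7 k11 => Tr_decFinish (N := N) hX2 (by omega) (by simp [k0, g0, hτ, hN]) k11 ?_ ?_ ?_)))))
      (?_ : N * 3 + 2 + (P.s + 4 + (N / P.B * (P.B + 5 + 2) + 2) +
        ((P.decStream (σ 0) N).2 * 3 + 2 + (N * 3 + 5))) ≤ _) fun _ h => h
  · intro i
    rw [k7, g7]; exact P.stream_lt _ _ _ _ _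
  · exact (lastOne_le _ _).trans heX
  · intro ρ hρ
    rw [hρ, k7, g7, hτ 0 (by omega) (by omega)]; rfl
  · unfold decSteps; nlinarith

end Params

/-- Arrays given to the encoder: the length, the cover word, the indicator of the frozen positions
and the message. -/
structure Input where
  N : ℕ
  w : ℕ → ℕ
  fr : ℕ → ℕ
  msg : ℕ → ℕ

namespace Params

variable (P : Params) (I : Input)

/-! ### The encoder as a function on arrays -/

/-- The number of blocks. -/
def M : ℕ := I.N / P.B

/-- The number of frozen positions in block `j`. -/
def frz (j : ℕ) : ℕ := ∑ p ∈ Finset.range P.B, I.fr (j * P.B + 1 + p)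

/-- The number of bits that block `j` can store, or `0` if it is below the threshold. -/
def cap (j : ℕ) : ℕ := if P.κ ≤ P.B - P.frz I j - P.g then P.B - P.frz I j - P.g else 0

/-- The potential whose minimum is the place to start. -/
def pot : ℕ → ℕ
  | 0 => P.s * P.M I
  | j + 1 => pot j + P.κ * (if 0 < P.cap I j then 1 else 0) - P.s

/-- The minimum of the potential on `0, …, n - 1`, and the place where it is attained. -/
def argmin : ℕ → ℕ × ℕ
  | 0 => (P.s * P.M I + 1, 0)
  | j + 1 => if P.pot I j < (argmin j).1 then (P.pot I j, j) else argmin j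

/-- The block where the encoder starts. -/
def first : ℕ := (P.argmin I (P.M I)).2

/-- The `x`-th visited block. -/
def visit (x : ℕ) : ℕ := (P.first I + x) % P.M I

/-- The time when block `j` is visited. -/
def time (j : ℕ) : ℕ := (j + P.M I - P.first I) % P.M I

/-- The length of the stream up to the terminator. -/
def need : ℕ := P.s * P.M I + I.msg 0 + 1

/-- The number of bits that can be stored in block `j` when the start is fixed. -/
def cap' (j : ℕ) : ℕ := if j = P.first I then P.κ else P.cap I j

/-- The length of the stream before the `x`-th visited block. -/
def pre : ℕ → ℕ
  | 0 => P.s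
  | x + 1 => pre x + if pre x < P.need I then P.cap' I (P.visit I x) else 0

/-- The number of bits stored in the `x`-th visited block. -/
def used (x : ℕ) : ℕ := if P.pre I x < P.need I then P.cap' I (P.visit I x) else 0

theorem pre_succ (x : ℕ) : P.pre I (x + 1) = P.pre I x + P.used I x := rfl

/-- The stream: the numbers of bits stored in the blocks, the message, and a final `1`. -/
def strm (i : ℕ) : ℕ :=
  if i < P.s * P.M I then P.used I (i / P.s) / 2 ^ (i % P.s) % 2
  else if i < P.s * P.M I + I.msg 0 then I.msg (i - P.s * P.M I + 1)
  else if i = P.s * P.M I + I.msg 0 then 1 else 0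

/-- The number written into block `j`. -/
def content (j : ℕ) : ℕ :=
  P.inv (P.used I (P.time I j)) (num (fun p => I.fr (j * P.B + 1 + p)) P.B) (P.blk I.w j)
    (num (fun i => P.strm I (P.pre I (P.time I j) + i)) P.B)

/-- The word after the first `x` visited blocks have been written. -/
def written (x i : ℕ) : ℕ :=
  if 1 ≤ i ∧ (i - 1) / P.B < P.M I ∧ P.time I ((i - 1) / P.B) < x then
    P.content I ((i - 1) / P.B) / 2 ^ ((i - 1) % P.B) % 2 else I.w i

/-- The number of ones that have to be added to make the weight point to the first block. -/
def deficit : ℕ :=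
  (P.first I + P.M I - (∑ p ∈ Finset.range I.N, P.written I (P.M I) (p + 1)) % P.M I) % P.M I

/-- The indicator of the free positions in blocks that store nothing. -/
def spare (p : ℕ) : ℕ :=
  if P.used I (P.time I (p / P.B)) = 0 ∧ I.fr (p + 1) = 0 then 1 else 0

def spareCount (p : ℕ) : ℕ := ∑ q ∈ Finset.range p, P.spare I q

/-- The indicator of the positions where a one is added. -/
def flip (p : ℕ) : ℕ := if P.spare I p = 1 ∧ P.spareCount I p < P.deficit I then 1 else 0

/-- The word after `n` steps of the adjustment of the weight. -/
def adjusted (n i : ℕ) : ℕ :=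
  P.written I (P.M I) i + if 1 ≤ i ∧ i ≤ n then P.flip I (i - 1) else 0

/-- The encoded word. -/
def encode (i : ℕ) : ℕ := P.adjusted I (P.M I * P.B) i

/-! ### The encoder as a program -/

/-- Array 6 receives the capacities; scalars 12, 13 and 11 hold the potential, its minimum so far
and the place of the minimum. The place is updated before the minimum, since both updates compare
with the old minimum. -/
def encScanBody : Cmd :=
  .seq (.assign 9 (.lit 0) (.op .sub (.op .sub (.lit P.B)
    (sumE 1 (.op .add (.op .mul (var 4) (.lit P.B)) (.lit 1)) P.B)) (.lit P.g))) <|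
  .seq (.assign 10 (.lit 0) (.op .mul (var 9) (.op .lt (.lit P.κ) (.op .add (var 9) (.lit 1))))) <|
  .seq (.assign 6 (var 4) (var 10)) <|
  .seq (.assign 11 (.lit 0) (.op .add (.op .mul (.op .lt (var 12) (var 13)) (var 4))
    (.op .mul (.op .lt (var 13) (.op .add (var 12) (.lit 1))) (var 11)))) <|
  .seq (.assign 13 (.lit 0) (.op .add (.op .mul (.op .lt (var 12) (var 13)) (var 12))
    (.op .mul (.op .lt (var 13) (.op .add (var 12) (.lit 1))) (var 13)))) <|
  .assign 12 (.lit 0) (.op .sub (.op .add (var 12)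
    (.op .mul (.lit P.κ) (.op .lt (.lit 0) (var 10)))) (.lit P.s))

def encScan : Cmd :=
  .seq (.assign 12 (.lit 0) (.op .mul (.lit P.s) P.blocksE)) <|
  .seq (.assign 13 (.lit 0) (.op .add (.op .mul (.lit P.s) P.blocksE) (.lit 1)))
  (forUp 4 P.blocksE P.encScanBody)

/-- Contents of early blocks include statuses of later ones, so all statuses are fixed before any
block is written. This is possible because they depend only on the capacities and on the total
length needed. Array 14 records them by block. -/
def encStatusBody : Cmd :=
  .seq (.assign 10 (.lit 0) (.op .mul (.op .lt (var 8)
    (.op .add (.op .add (.op .mul (.lit P.s) P.blocksE) (var 2)) (.lit 1))) (.get 6 (var 5)))) <|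
  .seq (.assign 14 (var 5) (var 10)) <|
  .seq (.assign 9 (.lit 0) (.op .mul (.lit P.s) (var 4))) <|
  .seq (writeBits 7 9 10 P.s) <|
  .seq (.assign 8 (.lit 0) (.op .add (var 8) (var 10)))
  P.nextBlock

def encStatus : Cmd :=
  .seq (.assign 6 (var 11) (.lit P.κ)) <|
  .seq (.assign 8 (.lit 0) (.lit P.s)) <|
  .seq (.assign 5 (.lit 0) (var 11))
  (forUp 4 P.blocksE P.encStatusBody)

def encMsg : Cmd :=
  .seq (forUp 4 (var 2) (.assign 7 (.op .add (.op .mul (.lit P.s) P.blocksE) (var 4))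
    (.get 2 (.op .add (var 4) (.lit 1)))))
  (.assign 7 (.op .add (.op .mul (.lit P.s) P.blocksE) (var 2)) (.lit 1))

def encBlocksBody : Cmd :=
  .seq (.assign 10 (.lit 0) (.get 14 (var 5))) <|
  .seq (.assign 16 (.lit 0) (.op .add (.op .mul (var 5) (.lit P.B)) (.lit 1))) <|
  .seq (.assign 9 (.lit 0) (look (P.B + 1) (var 10) fun k =>
    look (2 ^ P.B) (numE 1 (var 16) P.B) fun F =>
    look (2 ^ P.B) (numE 0 (var 16) P.B) fun V =>
    look (2 ^ P.B) (numE 7 (var 8) P.B) fun Y => .lit (P.inv k F V Y))) <|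
  .seq (writeBits 0 16 9 P.B) <|
  .seq (.assign 8 (.lit 0) (.op .add (var 8) (var 10)))
  P.nextBlock

def encBlocks : Cmd :=
  .seq (.assign 8 (.lit 0) (.lit P.s)) <|
  .seq (.assign 5 (.lit 0) (var 11))
  (forUp 4 P.blocksE P.encBlocksBody)

/-- Scalar 15 counts the ones still to be added; they are placed greedily on spare positions. -/
def encAdjustBody : Cmd :=
  .seq (.assign 9 (.lit 0) (.op .mul (.op .mul
    (.op .eq (.get 14 (.op .div (var 4) (.lit P.B))) (.lit 0))
    (.op .eq (.get 1 (.op .add (var 4) (.lit 1))) (.lit 0)))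
    (.op .lt (.lit 0) (var 15)))) <|
  .seq (.assign 0 (.op .add (var 4) (.lit 1))
    (.op .add (.get 0 (.op .add (var 4) (.lit 1))) (var 9)))
  (.assign 15 (.lit 0) (.op .sub (var 15) (var 9)))

def encAdjust : Cmd :=
  .seq (sumLoop 15) <|
  .seq (.assign 15 (.lit 0) (.op .mod (.op .sub (.op .add (var 11) P.blocksE)
    (.op .mod (var 15) P.blocksE)) P.blocksE))
  (forUp 4 (.op .mul P.blocksE (.lit P.B)) P.encAdjustBody)

/-- The encoder. -/
def encoder : Cmd :=
  .seq P.encScan <| .seq P.encStatus <| .seq P.encMsg <| .seq P.encBlocks P.encAdjust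

end Params

/-- `τ` agrees with `σ` on the arrays in `l`. -/
def Keep (l : List ℕ) (τ σ : Mem) : Prop := ∀ a ∈ l, τ a = σ a

/-! ### Verification of the encoder program. -/

namespace Params

variable {P : Params} {I : Input}

/-- The arrays and the bound on the memory are as required. -/
structure Ok (P : Params) (I : Input) (X : ℕ) : Prop where
  bound : P.bound I.N ≤ X
  pos : 0 < P.M I
  w_zero : I.w 0 = I.N
  w_lt : ∀ p, I.w (p + 1) < 2
  fr_lt : ∀ p, I.fr (p + 1) < 2
  msg_lt : ∀ p, I.msg (p + 1) < 2
  msg_le : I.msg 0 ≤ I.N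

variable {X : ℕ} {σ : Mem} {Q : Mem → Prop}

theorem κ_le : P.κ ≤ P.B := by
  rw [P.B_eq]; have := P.two_le_E; nlinarith [Nat.zero_le P.κ]

theorem cap_le (j : ℕ) : P.cap I j ≤ P.B := by unfold cap; split_ifs <;> omega

theorem cap'_le (j : ℕ) : P.cap' I j ≤ P.B := by
  unfold cap'; split_ifs
  · exact κ_le
  · exact cap_le j

theorem used_le (x : ℕ) : P.used I x ≤ P.B := by
  unfold used; split_ifs
  · exact cap'_le _
  · omega

theorem pot_le (x : ℕ) : P.pot I x ≤ P.s * P.M I + P.κ * x := by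
  induction x with
  | zero => simp [pot]
  | succ x ih => rw [pot, Nat.mul_succ]; split_ifs <;> omega

theorem argmin_le (x : ℕ) : (P.argmin I x).1 ≤ P.s * P.M I + 1 ∧ (P.argmin I x).2 ≤ x := by
  induction x with
  | zero => simp [argmin]
  | succ x ih =>
    have := pot_le (P := P) (I := I) x
    rw [argmin]
    split_ifs with h
    · exact ⟨by dsimp only; omega, by dsimp only; omega⟩
    · exact ⟨ih.1, by omega⟩

theorem pre_le (x : ℕ) : P.pre I x ≤ P.s + x * 2 ^ P.s := by
  induction x with
  | zero => simp [pre]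
  | succ x ih =>
    rw [pre_succ, Nat.succ_mul]
    have := used_le (P := P) (I := I) x
    have := P.lt_s
    omega

theorem Ok.potX (h : Ok P I X) : P.s * P.M I + P.κ * P.M I + 1 ≤ X := by
  refine le_trans ?_ h.bound
  have h1 : P.s ≤ 2 ^ P.s := Nat.lt_two_pow_self.le
  have h2 : P.κ ≤ 2 ^ P.s := κ_le.trans P.lt_s.le
  have h3 : 0 < P.B := by
    rcases Nat.eq_zero_or_pos P.B with h0 | h0
    · have := h.pos; rw [M, h0, Nat.div_zero] at this; omega
    · exact h0
  have h4 : 2 ^ P.s * 2 ≤ 2 ^ (P.B + P.s) := by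
    rw [← pow_succ]; exact Nat.pow_le_pow_right (by omega) (by omega)
  have h5 : P.M I ≤ I.N := Nat.div_le_self _ _
  have h6 : 1 ≤ 2 ^ P.s := Nat.one_le_two_pow
  unfold Params.bound
  calc P.s * P.M I + P.κ * P.M I + 1 ≤ 2 ^ P.s * I.N + 2 ^ P.s * I.N + 2 ^ P.s := by gcongr
    _ ≤ (I.N + 2) * (2 ^ P.s * 2) := by nlinarith
    _ ≤ _ := by gcongr

theorem Ok.MX (h : Ok P I X) : P.M I + 2 ≤ X := by
  have h5 : P.M I ≤ I.N := Nat.div_le_self _ _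
  have := (bound_facts h.bound).2.1
  omega

theorem Tr_encScan (h : Ok P I X) (h0 : σ 0 = I.w) (h1 : σ 1 = I.fr) (h6 : σ 6 = fun _ => 0)
    (h11 : σ 11 0 = 0)
    (hQ : ∀ τ : Mem, Keep [0, 1, 2, 7, 14, 15] τ σ →
      τ 6 = (fun j => if j < P.M I then P.cap I j else 0) → τ 11 0 = P.first I → Q τ) :
    Tr X P.encScan σ (P.M I * 8 + 4) Q := by
  obtain ⟨hX2, hXN, hXB, hXs, hXe⟩ := bound_facts h.bound
  have hMX := h.MX
  have hpX := h.potX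
  refine .mono (.seq (.assign hX2 (i := 0) (n := P.s * P.M I) rfl (by simp [h0, h.w_zero, M])
    (by omega) (.seq (.assign hX2 (i := 0) (n := P.s * P.M I + 1) rfl
      (by simp [h0, h.w_zero, M]) (by omega)
    (.forUp hX2 (m := 6) (P.M I) (by omega) (fun x τ => Keep [0, 1, 2, 7, 14, 15] τ σ ∧
      τ 6 = (fun j => if j < x then P.cap I j else 0) ∧ τ 12 0 = P.pot I x ∧
      τ 13 0 = (P.argmin I x).1 ∧ τ 11 0 = (P.argmin I x).2) ?_ ?_ ?_ ?_)))))
    (show 1 + (1 + (P.M I * 8 + 2)) ≤ P.M I * 8 + 4 by omega) fun _ h => h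
  · simp [Keep, h6, pot, argmin, h11]
  · rintro x - τ ⟨hk, -⟩
    simp [hk 0 (by simp), h0, h.w_zero, M]
  · rintro x hx τ ⟨hk, g6, g12, g13, g11⟩ g4
    have hcap := cap_le (P := P) (I := I) x
    have hBX : P.B ≤ X := Nat.lt_two_pow_self.le.trans hXB
    have hpot := pot_le (P := P) (I := I) x
    have hpot' := pot_le (P := P) (I := I) (x + 1)
    have harg := argmin_le (P := P) (I := I) x
    have hκ : P.κ * x ≤ P.κ * P.M I := Nat.mul_le_mul_left _ hx.le
    have hκ' : P.κ * (x + 1) ≤ P.κ * P.M I := Nat.mul_le_mul_left _ hx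
    have harg' := argmin_le (P := P) (I := I) (x + 1)
    refine .mono (.seq (.assign hX2 (i := 0) (n := P.B - P.frz I x - P.g) rfl ?_ (by omega)
      (.seq (.assign hX2 (i := 0) (n := P.cap I x) rfl ?_ (by omega)
      (.seq (.assign hX2 (i := x) (n := P.cap I x) (by simp [g4]) (by simp) (by omega)
      (.seq (.assign hX2 (i := 0) (n := (P.argmin I (x + 1)).2) rfl ?_ (by omega)
      (.seq (.assign hX2 (i := 0) (n := (P.argmin I (x + 1)).1) rfl ?_ (by omega)
      (.assign hX2 (i := 0) (n := P.pot I (x + 1)) rfl ?_ (by omega) ?_)))))))))))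
      (show 1 + (1 + (1 + (1 + (1 + 1)))) ≤ 6 by omega) fun _ h => h
    · simp [sumE_eval, hk 1 (by simp), h1, g4, frz]
    · simp only [cap, var, Expr.eval_op, Expr.eval_get, Expr.eval_lit, Mem.set_same,
        Function.update_self, Op.eval_mul, Op.eval_lt, Op.eval_add, Nat.lt_succ_iff]
      split_ifs <;> simp
    · simp only [argmin]
      by_cases hc : P.pot I x < (P.argmin I x).1
      · simp [g12, g13, g4, hc, Nat.not_lt.mpr (Nat.succ_le_of_lt hc)]
      · simp [g12, g13, g11, hc, Nat.lt_succ_of_le (Nat.le_of_not_lt hc)]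
    · simp only [argmin]
      by_cases hc : P.pot I x < (P.argmin I x).1
      · simp [g12, g13, hc, Nat.not_lt.mpr (Nat.succ_le_of_lt hc)]
      · simp [g12, g13, hc, Nat.lt_succ_of_le (Nat.le_of_not_lt hc)]
    · simp [g12, pot]
    · refine ⟨by simp [g4], fun a ha => ?_, ?_, by simp, by simp, by simp⟩
      · have := hk a ha
        simp at ha
        rcases ha with rfl | rfl | rfl | rfl | rfl | rfl <;> simpa using this
      · simp only [ne_eq, Nat.reduceEqDiff, not_false_eq_true, Mem.set_ne, Mem.set_same, g6]
        funext j
        rcases lt_trichotomy j x with hj | rfl | hj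
        · rw [Function.update_of_ne hj.ne, if_pos hj, if_pos (by omega)]
        · simp
        · rw [Function.update_of_ne hj.ne', if_neg (by omega), if_neg (by omega)]
  · rintro τ ⟨hk, g6, -, -, g11⟩
    exact hQ τ hk g6 g11

end Params

namespace Params

variable {P : Params} {I : Input} {X : ℕ} {σ : Mem} {Q : Mem → Prop}

theorem argmin_spec (n : ℕ) : (∀ i < n, (P.argmin I n).1 ≤ P.pot I i) ∧
    (0 < n → (P.argmin I n).2 < n ∧ P.pot I (P.argmin I n).2 = (P.argmin I n).1) := by
  induction n with
  | zero => simp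
  | succ n ih =>
    rw [argmin]
    split_ifs with h
    · refine ⟨fun i hi => ?_, fun _ => ⟨by simp, rfl⟩⟩
      rcases Nat.lt_succ_iff_lt_or_eq.mp hi with h' | rfl
      · exact h.le.trans (ih.1 i h')
      · exact le_rfl
    · have hn : 0 < n := by
        rcases Nat.eq_zero_or_pos n with rfl | h'
        -- The initial minimum sM + 1 exceeds the potential sM at 0, so the first comparison always
        -- succeeds.
        · simp [argmin, pot] at h
        · exact h'
      refine ⟨fun i hi => ?_, fun _ => ⟨(ih.2 hn).1.trans (by omega), (ih.2 hn).2⟩⟩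
      rcases Nat.lt_succ_iff_lt_or_eq.mp hi with h' | rfl
      · exact ih.1 i h'
      · omega

theorem first_lt (hM : 0 < P.M I) : P.first I < P.M I := ((argmin_spec _).2 hM).1

theorem pot_first_le (hM : 0 < P.M I) {i : ℕ} (hi : i < P.M I) :
    P.pot I (P.first I) ≤ P.pot I i :=
  ((argmin_spec _).2 hM).2.le.trans ((argmin_spec _).1 i hi)

theorem visit_lt (hM : 0 < P.M I) (x : ℕ) : P.visit I x < P.M I := Nat.mod_lt _ hM

theorem time_lt (hM : 0 < P.M I) (j : ℕ) : P.time I j < P.M I := Nat.mod_lt _ hM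

theorem time_visit (hM : 0 < P.M I) {x : ℕ} (hx : x < P.M I) : P.time I (P.visit I x) = x := by
  have := first_lt hM
  unfold time visit
  rcases lt_or_ge (P.first I + x) (P.M I) with h | h
  · rw [Nat.mod_eq_of_lt h, show P.first I + x + P.M I - P.first I = x + P.M I by omega,
      Nat.add_mod_right, Nat.mod_eq_of_lt hx]
  · rw [Nat.mod_eq_sub_mod h, Nat.mod_eq_of_lt (a := P.first I + x - P.M I) (by omega),
      show P.first I + x - P.M I + P.M I - P.first I = x by omega, Nat.mod_eq_of_lt hx]

theorem visit_time (hM : 0 < P.M I) {j : ℕ} (hj : j < P.M I) : P.visit I (P.time I j) = j := by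
  have := first_lt hM
  unfold time visit
  rcases le_or_gt (P.first I) j with h | h
  · rw [show j + P.M I - P.first I = j - P.first I + P.M I by omega, Nat.add_mod_right,
      Nat.mod_eq_of_lt (a := j - P.first I) (by omega),
      show P.first I + (j - P.first I) = j by omega, Nat.mod_eq_of_lt hj]
  · rw [Nat.mod_eq_of_lt (a := j + P.M I - P.first I) (by omega),
      show P.first I + (j + P.M I - P.first I) = j + P.M I by omega, Nat.add_mod_right,
      Nat.mod_eq_of_lt hj]

theorem eq_visit_iff (hM : 0 < P.M I) {x j : ℕ} (hx : x < P.M I) (hj : j < P.M I) :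
    j = P.visit I x ↔ P.time I j = x :=
  ⟨fun h => h ▸ time_visit hM hx, fun h => h ▸ (visit_time hM hj).symm⟩

theorem visit_succ (x : ℕ) : (P.visit I x + 1) % P.M I = P.visit I (x + 1) := by
  simp [visit, add_assoc]

/-- This is one round of filling a table with rows of s bits; it maintains the loop invariant for
the statuses. -/
theorem putBits_rows (g : ℕ → ℕ) (s x : ℕ) :
    putBits (fun i => if i < s * x then g (i / s) / 2 ^ (i % s) % 2 else 0) (s * x) (g x) s =
      fun i => if i < s * (x + 1) then g (i / s) / 2 ^ (i % s) % 2 else 0 := by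
  funext i
  unfold putBits
  rw [Nat.mul_succ]
  by_cases h : s * x ≤ i ∧ i < s * x + s
  · obtain ⟨r, rfl⟩ := Nat.exists_eq_add_of_le h.1
    have hr : r < s := by omega
    rw [if_pos h, if_pos h.2, Nat.mul_add_div (by omega), Nat.mul_add_mod, Nat.div_eq_of_lt hr,
      Nat.mod_eq_of_lt hr]
    simp
  · rw [if_neg h]
    beta_reduce
    by_cases h' : i < s * x
    · rw [if_pos h', if_pos (by omega)]
    · rw [if_neg h', if_neg (by omega)]

theorem Tr_encStatus (h : Ok P I X) (h0 : σ 0 = I.w) (h2 : σ 2 = I.msg)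
    (h6 : σ 6 = fun j => if j < P.M I then P.cap I j else 0) (h11 : σ 11 0 = P.first I)
    (h7 : σ 7 = fun _ => 0) (h14 : σ 14 = fun _ => 0)
    (hQ : ∀ τ : Mem, Keep [0, 1, 2, 11, 15] τ σ →
      τ 7 = (fun i => if i < P.s * P.M I then P.used I (i / P.s) / 2 ^ (i % P.s) % 2 else 0) →
      τ 14 = (fun j => if j < P.M I then P.used I (P.time I j) else 0) → Q τ) :
    Tr X P.encStatus σ (P.M I * (P.s + 8) + 5) Q := by
  obtain ⟨hX2, hXN, hXB, hXs, hXe⟩ := bound_facts h.bound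
  have hMX := h.MX
  have hpX := h.potX
  have hM := h.pos
  have hf := first_lt hM
  have hBX : P.B ≤ X := Nat.lt_two_pow_self.le.trans hXB
  have hsX : P.s ≤ X := Nat.lt_two_pow_self.le.trans hXs
  have hκX := (κ_le (P := P)).trans hBX
  refine .mono (.seq (.assign hX2 (i := P.first I) (n := P.κ) (by simp [h11]) (by simp) hκX
    (.seq (.assign hX2 (i := 0) (n := P.s) rfl (by simp) hsX
    (.seq (.assign hX2 (i := 0) (n := P.first I) rfl (by simp [h11]) (by omega)
    (.forUp hX2 (m := P.s + 6) (P.M I) (by omega) (fun x τ => Keep [0, 1, 2, 11, 15] τ σ ∧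
      τ 6 = (fun j => if j < P.M I then P.cap' I j else 0) ∧ τ 8 0 = P.pre I x ∧
      τ 5 0 = P.visit I x ∧
      τ 7 = (fun i => if i < P.s * x then P.used I (i / P.s) / 2 ^ (i % P.s) % 2 else 0) ∧
      τ 14 = (fun j => if j < P.M I ∧ P.time I j < x then P.used I (P.time I j) else 0))
      ?_ ?_ ?_ ?_)))))))
    (show 1 + (1 + (1 + (P.M I * (P.s + 6 + 2) + 2))) ≤ _ by
      rw [show P.s + 6 + 2 = P.s + 8 by ring]; omega) fun _ h => h
  · refine ⟨by simp [Keep], ?_, by simp [pre], ?_, by simp [h7], by simp [h14]⟩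
    -- Overwriting the capacity of the first block by κ turns `cap` into `cap'`.
    · simp only [ne_eq, Nat.reduceEqDiff, not_false_eq_true, Mem.set_ne, Mem.set_same, h6]
      funext j
      by_cases hj : j = P.first I
      · subst hj; simp [cap', hf]
      · rw [Function.update_of_ne hj]; simp [cap', hj]
    · simp [visit, Nat.mod_eq_of_lt hf]
  · rintro x - τ ⟨hk, -⟩
    simp [hk 0 (by simp), h0, h.w_zero, M]
  · rintro x hx τ ⟨hk, g6, g8, g5, g7, g14⟩ g4
    have hu := used_le (P := P) (I := I) x
    have hpre := pre_le (P := P) (I := I) (x + 1)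
    have hpre' : P.pre I (x + 1) ≤ X := by
      refine hpre.trans (le_trans ?_ hXe)
      gcongr
      exact hx.le
    have hsx : P.s * x ≤ X := by
      have := Nat.mul_le_mul_left P.s hx.le
      omega
    have g0 := hk 0 (by simp)
    have g2 := hk 2 (by simp)
    have hv := visit_lt (P := P) (I := I) hM
    refine .mono (.seq (.assign hX2 (i := 0) (n := P.used I x) rfl ?_ (hu.trans hBX)
      (.seq (.assign hX2 (i := P.visit I x) (n := P.used I x) (by simp [g5]) (by simp)
        (hu.trans hBX)
      (.seq (.assign hX2 (i := 0) (n := P.s * x) rfl (by simp [g4]) hsx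
      (.seq (.writeBits hX2 P.s (by omega) (by omega)
      (.seq (.assign hX2 (i := 0) (n := P.pre I (x + 1)) rfl (by simp [g8, pre_succ]) hpre'
      (.assign hX2 (i := 0) (n := P.visit I (x + 1)) rfl ?_ ((hv _).le.trans (by omega)) ?_)))))))))))
      (show 1 + (1 + (1 + ((P.s + 1) + (1 + 1)))) ≤ P.s + 6 by omega) fun _ h => h
    · have hv' : P.visit I x < I.N / P.B := hv x
      simp only [used]
      simp [g0, g2, h0, h2, h.w_zero, g8, g5, g6, hv', need, M]
    · rw [← visit_succ]
      simp [g5, g0, h0, h.w_zero, M]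
    · refine ⟨by simp [g4], fun a ha => ?_, by simp [g6], by simp, by simp, ?_, ?_⟩
      · have := hk a ha
        simp at ha
        rcases ha with rfl | rfl | rfl | rfl | rfl <;> simpa using this
      · simp only [ne_eq, Nat.reduceEqDiff, not_false_eq_true, Mem.set_ne, Mem.set_same, g7,
          Function.update_self]
        exact putBits_rows _ _ _
      · simp only [ne_eq, Nat.reduceEqDiff, not_false_eq_true, Mem.set_ne, Mem.set_same, g14]
        funext j
        by_cases hj : j = P.visit I x
        · rw [hj, Function.update_self, time_visit hM hx, if_pos ⟨hv _, by omega⟩]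
        · rw [Function.update_of_ne hj]
          by_cases hjM : j < P.M I
          · rw [eq_visit_iff hM hx hjM] at hj
            simp only [hjM, true_and]
            by_cases hlt : P.time I j < x
            · rw [if_pos hlt, if_pos (by omega)]
            · rw [if_neg hlt, if_neg (by omega)]
          · simp [hjM]
  · rintro τ ⟨hk, -, -, -, g7, g14⟩
    refine hQ τ hk g7 ?_
    rw [g14]; funext j; simp [time_lt hM]

theorem Tr_encMsg (h : Ok P I X) (h0 : σ 0 = I.w) (h2 : σ 2 = I.msg)
    (h7 : σ 7 = fun i => if i < P.s * P.M I then P.used I (i / P.s) / 2 ^ (i % P.s) % 2 else 0)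
    (hQ : ∀ τ : Mem, Keep [0, 1, 2, 11, 14, 15] τ σ → τ 7 = P.strm I → Q τ) :
    Tr X P.encMsg σ (I.N * 3 + 3) Q := by
  obtain ⟨hX2, hXN, hXB, hXs, hXe⟩ := bound_facts h.bound
  have hKN := h.msg_le
  refine .mono (.seq (.forUp hX2 (m := 1) (I.msg 0) (by omega)
    (fun x τ => Keep [0, 1, 2, 11, 14, 15] τ σ ∧
      τ 7 = (fun i => if i < P.s * P.M I then P.used I (i / P.s) / 2 ^ (i % P.s) % 2
        else if i < P.s * P.M I + x then I.msg (i - P.s * P.M I + 1) else 0)) ?_ ?_ ?_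
    fun τ hτ => .assign hX2 (i := P.s * P.M I + I.msg 0) (n := 1) ?_ (by simp) (by omega)
      (hQ _ (fun a ha => ?_) ?_)))
    (show I.msg 0 * 3 + 2 + 1 ≤ I.N * 3 + 3 by omega) fun _ h => h
  · refine ⟨by simp [Keep], ?_⟩
    simp only [ne_eq, Nat.reduceEqDiff, not_false_eq_true, Mem.set_ne, h7]
    funext i
    split_ifs <;> first | rfl | omega
  · rintro x - τ ⟨hk, -⟩
    simp [hk 2 (by simp), h2]
  · rintro x hx τ ⟨hk, g7⟩ g4
    refine .assign hX2 (i := P.s * P.M I + x) (n := I.msg (x + 1))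
      (by simp [hk 0 (by simp), h0, h.w_zero, M, g4]) (by simp [hk 2 (by simp), h2, g4])
      ((h.msg_lt _).le.trans hX2) ⟨by simp [g4], fun a ha => ?_, ?_⟩
    · have := hk a ha
      simp at ha
      rcases ha with rfl | rfl | rfl | rfl | rfl | rfl <;> simpa using this
    · simp only [ne_eq, Nat.reduceEqDiff, not_false_eq_true, Mem.set_ne, Mem.set_same, g7]
      funext i
      by_cases hi : i = P.s * P.M I + x
      · subst hi
        rw [Function.update_self, if_neg (by omega), if_pos (by omega)]; congr 1; omega
      · rw [Function.update_of_ne hi]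
        split_ifs <;> first | rfl | omega
  · simp [hτ.1 0 (by simp), hτ.1 2 (by simp), h0, h2, h.w_zero, M]
  · have := hτ.1 a ha
    simp at ha
    rcases ha with rfl | rfl | rfl | rfl | rfl | rfl <;> simpa using this
  · simp only [Mem.set_same, hτ.2]
    funext i
    unfold strm
    by_cases hi : i = P.s * P.M I + I.msg 0
    · subst hi
      rw [Function.update_self, if_neg (by omega), if_neg (by omega), if_pos rfl]
    · rw [Function.update_of_ne hi]
      split_ifs <;> rfl

end Params

namespace Params

variable {P : Params} {I : Input} {X : ℕ} {σ : Mem} {Q : Mem → Prop}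

theorem Ok.B_pos (h : Ok P I X) : 0 < P.B := by
  rcases Nat.eq_zero_or_pos P.B with h0 | h0
  · have := h.pos; rw [M, h0, Nat.div_zero] at this; omega
  · exact h0

theorem pos_block {B : ℕ} (j : ℕ) {p : ℕ} (hp : p < B) :
    (j * B + 1 + p - 1) / B = j ∧ (j * B + 1 + p - 1) % B = p := by
  rw [show j * B + 1 + p - 1 = B * j + p by rw [mul_comm]; omega, Nat.mul_add_div (by omega),
    Nat.mul_add_mod, Nat.div_eq_of_lt hp, Nat.mod_eq_of_lt hp]
  simp

theorem Ok.strm_lt (h : Ok P I X) (i : ℕ) : P.strm I i < 2 := by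
  unfold strm
  split_ifs
  · omega
  · exact h.msg_lt _
  · omega
  · omega

theorem Ok.fr_block (h : Ok P I X) (j p : ℕ) : I.fr (j * P.B + 1 + p) < 2 := by
  rw [show j * P.B + 1 + p = j * P.B + p + 1 by ring]; exact h.fr_lt _

theorem Ok.w_block (h : Ok P I X) (j p : ℕ) : I.w (j * P.B + 1 + p) < 2 := by
  rw [show j * P.B + 1 + p = j * P.B + p + 1 by ring]; exact h.w_lt _

theorem Ok.content_spec (h : Ok P I X) (j : ℕ) :
    P.content I j < 2 ^ P.B ∧
    (∀ p < P.B, I.fr (j * P.B + 1 + p) = 1 →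
      P.content I j / 2 ^ p % 2 = I.w (j * P.B + 1 + p)) ∧
    (P.used I (P.time I j) = 0 → ∀ p < P.B, I.fr (j * P.B + 1 + p) = 0 →
      P.content I j / 2 ^ p % 2 = 0) ∧
    (P.used I (P.time I j) + P.g + P.frz I j ≤ P.B →
      P.f (P.used I (P.time I j)) (P.content I j) =
        num (fun i => P.strm I (P.pre I (P.time I j) + i)) P.B % 2 ^ P.used I (P.time I j)) :=
  P.inv_spec (P.used I (P.time I j)) _ (fun p => I.fr (j * P.B + 1 + p))
    (fun p => I.w (j * P.B + 1 + p)) (h.fr_block j) (h.w_block j)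

theorem Ok.written_lt (h : Ok P I X) (x p : ℕ) : P.written I x (p + 1) < 2 := by
  unfold written
  split_ifs
  · omega
  · exact h.w_lt p

theorem written_zero (x : ℕ) : P.written I x 0 = I.w 0 := by simp [written]

theorem written_start : P.written I 0 = I.w := by funext i; simp [written]

theorem Ok.written_succ (h : Ok P I X) {x : ℕ} (hx : x < P.M I) :
    putBits (P.written I x) (P.visit I x * P.B + 1) (P.content I (P.visit I x)) P.B =
      P.written I (x + 1) := by
  funext i
  have hv := visit_lt h.pos x
  have ht := time_visit h.pos hx
  unfold putBits
  by_cases hi : P.visit I x * P.B + 1 ≤ i ∧ i < P.visit I x * P.B + 1 + P.B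
  · obtain ⟨p, rfl⟩ := Nat.exists_eq_add_of_le hi.1
    have hp : p < P.B := by omega
    rw [if_pos hi, written, (pos_block _ hp).1, (pos_block _ hp).2, ht, if_pos ⟨by omega, hv, by omega⟩,
      Nat.add_sub_cancel_left]
  · rw [if_neg hi]
    unfold written
    by_cases h1 : 1 ≤ i ∧ (i - 1) / P.B < P.M I
    · have hne : (i - 1) / P.B ≠ P.visit I x := by
        intro he
        have h2 := Nat.div_add_mod (i - 1) P.B
        have h3 := Nat.mod_lt (i - 1) h.B_pos
        rw [he, mul_comm] at h2
        omega
      rw [Ne, eq_visit_iff h.pos hx h1.2] at hne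
      simp only [h1, true_and]
      by_cases hlt : P.time I ((i - 1) / P.B) < x
      · rw [if_pos hlt, if_pos (by omega)]
      · rw [if_neg hlt, if_neg (by omega)]
    · rw [if_neg fun h' => h1 ⟨h'.1, h'.2.1⟩, if_neg fun h' => h1 ⟨h'.1, h'.2.1⟩]

/-- Each block is visited once, so the word can be overwritten in place: the look-up still sees the
cover word. -/
theorem Ok.blk_written (h : Ok P I X) {x : ℕ} (hx : x < P.M I) :
    P.blk (P.written I x) (P.visit I x) = P.blk I.w (P.visit I x) := by
  refine num_congr fun p hp => ?_
  rw [written, (pos_block _ hp).1, time_visit h.pos hx, if_neg (by omega)]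

theorem Tr_encBlocks (h : Ok P I X) (h0 : σ 0 = I.w) (h1 : σ 1 = I.fr) (h7 : σ 7 = P.strm I)
    (h11 : σ 11 0 = P.first I)
    (h14 : σ 14 = fun j => if j < P.M I then P.used I (P.time I j) else 0)
    (hQ : ∀ τ : Mem, Keep [1, 11, 14, 15] τ σ → τ 0 = P.written I (P.M I) → Q τ) :
    Tr X P.encBlocks σ (P.M I * (P.B + 8) + 4) Q := by
  obtain ⟨hX2, hXN, hXB, hXs, hXe⟩ := bound_facts h.bound
  have hMX := h.MX
  have hM := h.pos
  have hf := first_lt hM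
  have hBX : P.B ≤ X := Nat.lt_two_pow_self.le.trans hXB
  have hsX : P.s ≤ X := Nat.lt_two_pow_self.le.trans hXs
  refine .mono (.seq (.assign hX2 (i := 0) (n := P.s) rfl (by simp) hsX
    (.seq (.assign hX2 (i := 0) (n := P.first I) rfl (by simp [h11]) (by omega)
    (.forUp hX2 (m := P.B + 6) (P.M I) (by omega) (fun x τ => Keep [1, 7, 11, 14, 15] τ σ ∧
      τ 0 = P.written I x ∧ τ 8 0 = P.pre I x ∧ τ 5 0 = P.visit I x) ?_ ?_ ?_ ?_)))))
    (show 1 + (1 + (P.M I * (P.B + 6 + 2) + 2)) ≤ _ by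
      rw [show P.B + 6 + 2 = P.B + 8 by ring]; omega) fun _ h => h
  · simp [Keep, h0, written_start, pre, visit, Nat.mod_eq_of_lt hf]
  · rintro x - τ ⟨-, g0, -⟩
    simp [g0, written_zero, h.w_zero, M]
  · rintro x hx τ ⟨hk, g0, g8, g5⟩ g4
    have hu := used_le (P := P) (I := I) x
    have hpre' : P.pre I (x + 1) ≤ X := by
      refine (pre_le _).trans (le_trans ?_ hXe)
      gcongr
      exact hx.le
    have g1 := hk 1 (by simp)
    have g7 := hk 7 (by simp)
    have g14 := hk 14 (by simp)
    have hv := visit_lt (P := P) (I := I) hM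
    have hpos : P.visit I x * P.B + 1 ≤ X := by
      have h2 : (P.visit I x + 1) * P.B ≤ P.M I * P.B := Nat.mul_le_mul_right _ (hv x)
      have h3 : P.M I * P.B ≤ I.N := Nat.div_mul_le_self _ _
      have := h.B_pos
      rw [Nat.succ_mul] at h2
      omega
    have hc := (h.content_spec (P.visit I x)).1
    have hF : num (fun p => I.fr (P.visit I x * P.B + 1 + p)) P.B < 2 ^ P.B :=
      num_lt fun i _ => h.fr_block _ i
    have hV : P.blk I.w (P.visit I x) < 2 ^ P.B := num_lt fun i _ => h.w_block _ i
    have hY : num (fun i => P.strm I (P.pre I x + i)) P.B < 2 ^ P.B :=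
      num_lt fun i _ => h.strm_lt _
    refine .mono (.seq (.assign hX2 (i := 0) (n := P.used I x) rfl ?_ (hu.trans hBX)
      (.seq (.assign hX2 (i := 0) (n := P.visit I x * P.B + 1) rfl (by simp [g5]) hpos
      (.seq (.assign hX2 (i := 0) (n := P.content I (P.visit I x)) rfl ?_ (hc.le.trans hXB)
      (.seq (.writeBits hX2 P.B (by omega) (by omega)
      (.seq (.assign hX2 (i := 0) (n := P.pre I (x + 1)) rfl (by simp [g8, pre_succ]) hpre'
      (.assign hX2 (i := 0) (n := P.visit I (x + 1)) rfl ?_ ((hv _).le.trans (by omega)) ?_)))))))))))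
      (show 1 + (1 + (1 + ((P.B + 1) + (1 + 1)))) ≤ P.B + 6 by omega) fun _ h => h
    · simp [g14, h14, g5, hv, time_visit hM hx]
    · simp only [look_eval, numE_eval, Expr.eval_get, Expr.eval_lit, ne_eq, Nat.reduceEqDiff,
        not_false_eq_true, Mem.set_ne, Mem.set_same, Function.update_self, g0, g1, h1, g7, h7, g8,
        OfNat.zero_ne_ofNat, OfNat.one_ne_ofNat]
      have hVw := h.blk_written hx
      unfold blk at hVw
      rw [hVw]
      rw [blk] at hV
      rw [if_pos (by omega), if_pos hF, if_pos hV, if_pos hY, content, time_visit hM hx, blk]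
    · rw [← visit_succ]
      have : putBits (P.written I x) (P.visit I x * P.B + 1) (P.content I (P.visit I x)) P.B 0 =
          I.N := by rw [h.written_succ hx, written_zero, h.w_zero]
      simp [g5, g0, this, M]
    · refine ⟨by simp [g4], fun a ha => ?_, ?_, by simp, by simp⟩
      · have := hk a ha
        simp at ha
        rcases ha with rfl | rfl | rfl | rfl | rfl <;> simpa using this
      · rw [← h.written_succ hx]
        simp [g0]
  · rintro τ ⟨hk, g0, -, -⟩
    refine hQ τ (fun a ha => hk a ?_) g0
    simp at ha ⊢
    omega

theorem spareCount_succ (x : ℕ) : P.spareCount I (x + 1) = P.spareCount I x + P.spare I x :=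
  Finset.sum_range_succ _ _

theorem Tr_encAdjust (h : Ok P I X) (h0 : σ 0 = P.written I (P.M I)) (h1 : σ 1 = I.fr)
    (h11 : σ 11 0 = P.first I) (h15 : σ 15 = fun _ => 0)
    (h14 : σ 14 = fun j => if j < P.M I then P.used I (P.time I j) else 0)
    (hQ : ∀ τ : Mem, τ 0 = P.encode I → Q τ) :
    Tr X P.encAdjust σ (I.N * 8 + 5) Q := by
  obtain ⟨hX2, hXN, hXB, hXs, hXe⟩ := bound_facts h.bound
  have hMX := h.MX
  have hM := h.pos
  have hMB : P.M I * P.B ≤ I.N := Nat.div_mul_le_self _ _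
  have hN : σ 0 0 = I.N := by rw [h0, written_zero, h.w_zero]
  have hd : P.deficit I < P.M I := Nat.mod_lt _ hM
  refine .mono (.seq (Tr_sumLoop hX2 15 (by omega) (by omega) hN (by omega) (by simp [h15])
    (fun p => by rw [h0]; exact h.written_lt _ _) fun υ k15 hυ =>
    (.seq (.assign hX2 (i := 0) (n := P.deficit I) rfl ?_ (by omega)
    -- In the invariant the truncated difference of deficit and spare positions passed is the number
    -- of ones still to be added; it stays 0 once the deficit is met.
    (.forUp hX2 (m := 3) (P.M I * P.B) (by omega) (fun x τ => Keep [1, 14] τ σ ∧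
      τ 0 = P.adjusted I x ∧ τ 15 0 = P.deficit I - P.spareCount I x) ?_ ?_ ?_ ?_)))))
    (show I.N * 3 + 2 + (1 + (P.M I * P.B * 5 + 2)) ≤ I.N * 8 + 5 by omega) fun _ h => h
  · have h2 := hυ 0 (by omega) (by omega)
    have h3 := hυ 11 (by omega) (by omega)
    simp only [Expr.eval_op, Expr.eval_get, Expr.eval_lit, Op.eval_mod, Op.eval_sub, Op.eval_add,
      Op.eval_div, h2, h3, hN, h11, k15, h0]
    rfl
  · refine ⟨fun a ha => ?_, ?_, by simp [spareCount]⟩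
    · simp at ha
      rcases ha with rfl | rfl <;> simp [hυ]
    · have h2 := hυ 0 (by omega) (by omega)
      simp only [ne_eq, Nat.reduceEqDiff, not_false_eq_true, Mem.set_ne, h2, h0,
        OfNat.zero_ne_ofNat]
      funext i
      unfold adjusted
      rw [if_neg (by omega), Nat.add_zero]
  · rintro x - τ ⟨-, g0, -⟩
    simp [g0, adjusted, written_zero, h.w_zero, M]
  · rintro x hx τ ⟨hk, g0, g15⟩ g4
    have g1 := hk 1 (by simp)
    have g14 := hk 14 (by simp)
    have hxM : x / P.B < P.M I := Nat.div_lt_of_lt_mul (by rwa [mul_comm])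
    have hfl : P.flip I x ≤ 1 := by unfold flip; split_ifs <;> omega
    have hw := h.written_lt (P.M I) x
    have hval : P.adjusted I x (x + 1) = P.written I (P.M I) (x + 1) := by
      unfold adjusted; rw [if_neg (by omega), Nat.add_zero]
    refine .mono (.seq (.assign hX2 (i := 0) (n := P.flip I x) rfl ?_ (by omega)
      (.seq (.assign hX2 (i := x + 1) (n := P.adjusted I x (x + 1) + P.flip I x) (by simp [g4])
        (by simp [g4, g0]) (by omega)
      (.assign hX2 (i := 0) (n := P.deficit I - P.spareCount I (x + 1)) rfl ?_ (by omega) ?_)))))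
      (show 1 + (1 + 1) ≤ 3 by omega) fun _ h => h
    · simp only [Expr.eval_op, Expr.eval_get, Expr.eval_lit, Op.eval_mul, Op.eval_eq, Op.eval_lt,
        Op.eval_add, Op.eval_div, g14, h14, g4, g1, h1, g15, if_pos hxM, flip, spare,
        tsub_pos_iff_lt]
      by_cases c1 : P.used I (P.time I (x / P.B)) = 0 <;> by_cases c2 : I.fr (x + 1) = 0 <;>
        by_cases c3 : P.spareCount I x < P.deficit I <;> simp [c1, c2, c3]
    · simp only [var, Expr.eval_op, Expr.eval_get, Expr.eval_lit, Op.eval_sub, ne_eq,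
        Nat.reduceEqDiff, not_false_eq_true, Mem.set_ne, Mem.set_same, Function.update_self, g15,
        OfNat.ofNat_ne_zero]
      rw [spareCount_succ]
      have hs : P.spare I x ≤ 1 := by unfold spare; split_ifs <;> omega
      unfold flip
      split_ifs with hc <;> omega
    · refine ⟨by simp [g4], fun a ha => ?_, ?_, by simp⟩
      · have := hk a ha
        simp at ha
        rcases ha with rfl | rfl <;> simpa using this
      · simp only [ne_eq, Nat.reduceEqDiff, not_false_eq_true, Mem.set_ne, Mem.set_same, g0,
          OfNat.zero_ne_ofNat]
        funext i
        by_cases hi : i = x + 1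
        · subst hi
          rw [Function.update_self, hval, adjusted, if_pos (by omega)]
          simp
        · rw [Function.update_of_ne hi]
          unfold adjusted
          congr 1
          split_ifs <;> first | rfl | omega
  · rintro τ ⟨-, g0, -⟩
    exact hQ τ g0

/-- The number of steps of the encoder. -/
def encSteps (P : Params) (N : ℕ) : ℕ := N * (P.s + P.B + 35) + 25

theorem Tr_encoder (h : Ok P I X) (h0 : σ 0 = I.w) (h1 : σ 1 = I.fr) (h2 : σ 2 = I.msg)
    (hσ : ∀ a, 4 ≤ a → σ a = fun _ => 0) :
    Tr X P.encoder σ (P.encSteps I.N) fun τ => τ 0 = P.encode I := by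
  have hMN : P.M I ≤ I.N := Nat.div_le_self _ _
  refine .mono (.seq (Tr_encScan h h0 h1 (hσ _ (by omega)) (by simp [hσ]) fun τ k1 k6 k11 =>
    .seq (Tr_encStatus h (by simp [k1 0, h0]) (by simp [k1 2, h2]) k6 k11
      (by simp [k1 7, hσ]) (by simp [k1 14, hσ]) fun υ l1 l7 l14 =>
    .seq (Tr_encMsg h (by simp [l1 0, k1 0, h0]) (by simp [l1 2, k1 2, h2]) l7 fun ω m1 m7 =>
    .seq (Tr_encBlocks h (by simp [m1 0, l1 0, k1 0, h0]) (by simp [m1 1, l1 1, k1 1, h1]) m7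
      (by simp [m1 11, l1 11, k11]) (by simp [m1 14, l14]) fun ρ n1 n0 =>
    Tr_encAdjust h n0 (by simp [n1 1, m1 1, l1 1, k1 1, h1])
      (by simp [n1 11, m1 11, l1 11, k11]) (by simp [n1 15, m1 15, l1 15, k1 15, hσ])
      (by simp [n1 14, m1 14, l14]) fun _ h => h)))))
    (?_ : P.M I * 8 + 4 + (P.M I * (P.s + 8) + 5 + (I.N * 3 + 3 + (P.M I * (P.B + 8) + 4 +
      (I.N * 8 + 5)))) ≤ _) fun _ h => h
  have : P.M I * (8 + (P.s + 8) + (P.B + 8)) ≤ I.N * (8 + (P.s + 8) + (P.B + 8)) :=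
    Nat.mul_le_mul_right _ hMN
  unfold encSteps
  nlinarith

end Params

namespace Params

variable {P : Params} {I : Input} {X : ℕ}

/-! ### The encoder is correct -/

theorem sum_range_mul (h : ℕ → ℕ) (B M : ℕ) :
    ∑ p ∈ Finset.range (M * B), h p =
      ∑ j ∈ Finset.range M, ∑ q ∈ Finset.range B, h (j * B + q) := by
  induction M with
  | zero => simp
  | succ M ih => rw [Nat.succ_mul, Finset.sum_range_add, ih, Finset.sum_range_succ]

/-- The hypotheses on the message length, the frozen positions and the size of the input. -/
structure Fits (P : Params) (I : Input) (X : ℕ) : Prop extends Ok P I X where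
  s_pos : 0 < P.s
  large : P.B ≤ P.M I
  length : I.msg 0 + ∑ p ∈ Finset.range I.N, I.fr (p + 1) = I.N - I.N / P.E
  frozen : 0 < ∑ p ∈ Finset.range I.N, I.fr (p + 1)

/-- The number of usable blocks below `j`. -/
def us (P : Params) (I : Input) (j : ℕ) : ℕ :=
  ∑ i ∈ Finset.range j, if 0 < P.cap I i then 1 else 0

/-- The number of usable blocks among the first `x` visited ones. -/
def usVisit (P : Params) (I : Input) (x : ℕ) : ℕ :=
  ∑ y ∈ Finset.range x, if 0 < P.cap I (P.visit I y) then 1 else 0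

theorem us_succ (j : ℕ) : P.us I (j + 1) = P.us I j + if 0 < P.cap I j then 1 else 0 :=
  Finset.sum_range_succ _ _

theorem usVisit_succ (x : ℕ) :
    P.usVisit I (x + 1) = P.usVisit I x + if 0 < P.cap I (P.visit I x) then 1 else 0 :=
  Finset.sum_range_succ _ _

/-- Starting at sM keeps the truncated subtraction exact up to j = M, since only s is lost per
block. -/
theorem pot_add {j : ℕ} (hj : j ≤ P.M I) :
    P.pot I j + P.s * j = P.s * P.M I + P.κ * P.us I j := by
  induction j with
  | zero => simp [pot, us]
  | succ j ih =>
    have h1 := ih (by omega)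
    have h2 : P.s * (j + 1) ≤ P.s * P.M I := Nat.mul_le_mul_left _ hj
    rw [pot, us_succ, Nat.mul_succ, Nat.mul_add]
    rw [Nat.mul_succ] at h2
    omega

/-! ### Counting capacities, and the cycle lemma. -/

namespace Fits

theorem κ_facts (h : Fits P I X) : P.s + P.g ≤ P.κ ∧ 8 * P.s ≤ P.κ := by
  have h1 := P.le_κ
  have h2 := P.two_le_E
  have h3 := h.s_pos
  have h4 := P.g_eq
  have : 8 * P.s ≤ 4 * P.E * P.s := Nat.mul_le_mul_right _ (by omega)
  omega

/-- The rate gives away N / E positions, hence at least 4κ per block. This budget pays for all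
losses below, including the incomplete last block, as B ≤ Mκ. -/
theorem div_facts (h : Fits P I X) : P.M I * (4 * P.κ) ≤ I.N / P.E ∧ I.N < P.M I * P.B + P.B ∧
    P.M I * P.B ≤ I.N ∧ I.N / P.E ≤ I.N ∧ P.B ≤ P.M I * P.κ := by
  have hE := P.two_le_E
  have hMB : P.M I * P.B ≤ I.N := Nat.div_mul_le_self _ _
  refine ⟨?_, ?_, hMB, Nat.div_le_self _ _, ?_⟩
  · rw [Nat.le_div_iff_mul_le (by omega)]
    refine le_trans (le_of_eq ?_) hMB
    rw [P.B_eq]; ring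
  · have := Nat.lt_div_mul_add (a := I.N) h.B_pos
    exact this
  · have h1 := h.large
    have h2 := h.κ_facts
    have h3 := h.s_pos
    calc P.B ≤ P.M I * 1 := by omega
      _ ≤ _ := Nat.mul_le_mul_left _ (by omega)

theorem frz_sum_le (h : Fits P I X) :
    ∑ j ∈ Finset.range (P.M I), P.frz I j ≤ ∑ p ∈ Finset.range I.N, I.fr (p + 1) := by
  have h1 : ∑ j ∈ Finset.range (P.M I), P.frz I j =
      ∑ p ∈ Finset.range (P.M I * P.B), I.fr (p + 1) := by
    rw [sum_range_mul]
    refine Finset.sum_congr rfl fun j _ => Finset.sum_congr rfl fun p _ => ?_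
    congr 1; ring
  rw [h1]
  exact Finset.sum_le_sum_of_subset (Finset.range_subset_range.mpr h.div_facts.2.2.1)

theorem frz_le (h : Fits P I X) (j : ℕ) : P.frz I j ≤ P.B := by
  calc P.frz I j ≤ ∑ _p ∈ Finset.range P.B, 1 :=
        Finset.sum_le_sum fun p _ => by have := h.fr_block j p; omega
    _ = P.B := by simp

/-- An unusable block has fewer than κ + g ≤ 2κ free positions. Of the 4κ free positions per block
that are guaranteed on average, after the boundary loss, at least κ therefore lie in usable blocks,
so B·us ≥ Mκ. With sB ≤ κ² this gives the claim. -/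
theorem le_us (h : Fits P I X) : P.s * P.M I ≤ P.κ * P.us I (P.M I) := by
  obtain ⟨h1, h2, h3, h4, h5⟩ := h.div_facts
  obtain ⟨hκ, hκ'⟩ := h.κ_facts
  have hfs := h.frz_sum_le
  have hl := h.length
  have hblock : ∀ j, P.B ≤ P.frz I j + P.B * (if 0 < P.cap I j then 1 else 0) + (P.κ + P.g) := by
    intro j
    have := h.frz_le j
    unfold cap
    split_ifs <;> omega
  have hsum := Finset.sum_le_sum fun j (_ : j ∈ Finset.range (P.M I)) => hblock j
  simp only [Finset.sum_add_distrib, ← Finset.mul_sum, Finset.sum_const, Finset.card_range,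
    smul_eq_mul] at hsum
  rw [← us] at hsum
  have h6 : P.M I * (P.κ + P.g) ≤ P.M I * (2 * P.κ) := Nat.mul_le_mul_left _ (by omega)
  rw [Nat.mul_add] at h6
  have h7 : P.M I * P.κ ≤ P.B * P.us I (P.M I) := by
    have e1 : P.M I * (4 * P.κ) = 4 * (P.M I * P.κ) := by ring
    have e2 : P.M I * (2 * P.κ) = 2 * (P.M I * P.κ) := by ring
    omega
  have h8 : P.s * P.B ≤ P.κ * P.κ := by
    rw [P.B_eq]
    calc P.s * (4 * P.E * P.κ) = 4 * P.E * P.s * P.κ := by ring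
      _ ≤ _ := Nat.mul_le_mul_right _ P.le_κ
  refine Nat.le_of_mul_le_mul_right ?_ h.B_pos
  calc P.s * P.M I * P.B = P.M I * (P.s * P.B) := by ring
    _ ≤ P.M I * (P.κ * P.κ) := Nat.mul_le_mul_left _ h8
    _ = P.κ * (P.M I * P.κ) := by ring
    _ ≤ P.κ * (P.B * P.us I (P.M I)) := Nat.mul_le_mul_left _ h7
    _ = _ := by ring

theorem us_first_add (h : Fits P I X) {x : ℕ} (hx : x ≤ P.M I) :
    P.us I (P.first I) + P.usVisit I x = if P.first I + x < P.M I then P.us I (P.first I + x)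
      else P.us I (P.M I) + P.us I (P.first I + x - P.M I) := by
  have hf := first_lt h.pos
  induction x with
  | zero => simp [usVisit, hf]
  | succ x ih =>
    have ih := ih (by omega)
    rw [usVisit_succ, ← add_assoc, ih]
    rcases lt_trichotomy (P.first I + x + 1) (P.M I) with h1 | h1 | h1
    · have hv : P.visit I x = P.first I + x := Nat.mod_eq_of_lt (by omega)
      rw [if_pos (show P.first I + x < P.M I by omega), if_pos (show P.first I + (x + 1) < P.M I by omega), hv,
        ← us_succ]
      rfl
    · have hv : P.visit I x = P.first I + x := Nat.mod_eq_of_lt (by omega)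
      rw [if_pos (show P.first I + x < P.M I by omega), if_neg (show ¬P.first I + (x + 1) < P.M I by omega), hv,
        ← us_succ, h1,
        show P.first I + (x + 1) - P.M I = 0 by omega]
      simp [us]
    · have hv : P.visit I x = P.first I + x - P.M I := by
        rw [visit, Nat.mod_eq_sub_mod (by omega), Nat.mod_eq_of_lt (by omega)]
      rw [if_neg (show ¬P.first I + x < P.M I by omega), if_neg (show ¬P.first I + (x + 1) < P.M I by omega), hv,
        add_assoc, ← us_succ,
        show P.first I + x - P.M I + 1 = P.first I + (x + 1) - P.M I by omega]

/-- The cycle lemma: from the chosen start on, the blocks always keep up with the statuses. -/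
theorem le_usVisit (h : Fits P I X) {x : ℕ} (hx : x ≤ P.M I) : P.s * x ≤ P.κ * P.usVisit I x := by
  have hf := first_lt h.pos
  have h1 := h.us_first_add hx
  have h2 := pot_add (P := P) (I := I) hf.le
  have h3 : P.κ * (P.us I (P.first I) + P.usVisit I x) =
      P.κ * P.us I (P.first I) + P.κ * P.usVisit I x := by ring
  rw [h1] at h3
  split_ifs at h3 with hc
  · have h4 := pot_first_le h.pos hc
    have h5 := pot_add (P := P) (I := I) hc.le
    rw [Nat.mul_add] at h5
    omega
  -- The visits wrap around; by `le_us` the full circle adds κ·us(M) − sM ≥ 0 to the comparison of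
  -- potentials.
  · have h4 := pot_first_le h.pos (i := P.first I + x - P.M I) (by omega)
    have h5 := pot_add (P := P) (I := I) (j := P.first I + x - P.M I) (by omega)
    have h6 := h.le_us
    have h7 : P.s * (P.first I + x - P.M I) + P.s * P.M I = P.s * P.first I + P.s * x := by
      rw [← Nat.mul_add, ← Nat.mul_add]; congr 1; omega
    rw [Nat.mul_add] at h3
    omega

theorem visit_zero (h : Fits P I X) : P.visit I 0 = P.first I := Nat.mod_eq_of_lt (first_lt h.pos)

/-- The cycle lemma for a single visit forces the first block to be usable, so it really can store
the prescribed κ bits. -/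
theorem κ_le_cap_first (h : Fits P I X) : P.κ ≤ P.cap I (P.first I) := by
  have h1 := h.le_usVisit (x := 1) h.pos
  have h2 := h.s_pos
  have h3 : 0 < P.cap I (P.first I) := by
    by_contra hc
    rw [usVisit_succ, h.visit_zero, if_neg hc] at h1
    simp [usVisit] at h1
    omega
  unfold cap at h3 ⊢
  split_ifs at h3 ⊢ with hc
  · exact hc
  · omega

theorem κ_le_cap' {j : ℕ} (hj : 0 < P.cap I j) : P.κ ≤ P.cap' I j := by
  unfold cap'
  split_ifs
  · exact le_rfl
  · unfold cap at hj ⊢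
    split_ifs at hj ⊢ with hc
    · exact hc
    · omega

/-- This makes sequential decoding possible: the status of the x-th visited block lies entirely in
the stream before that block. While the stream is incomplete, usable blocks contribute at least κ
each and the cycle lemma applies; afterwards all statuses are present. -/
theorem le_pre (h : Fits P I X) {x : ℕ} (hx : x < P.M I) : P.s * (x + 1) ≤ P.pre I x := by
  have key : ∀ x, P.need I ≤ P.pre I x ∨ P.s + P.κ * P.usVisit I x ≤ P.pre I x := by
    intro x
    induction x with
    | zero => right; simp [pre, usVisit]
    | succ x ih =>
      rw [pre_succ, usVisit_succ]
      by_cases hn : P.pre I x < P.need I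
      · right
        have h1 : P.used I x = P.cap' I (P.visit I x) := if_pos hn
        rw [h1]
        have h2 : P.κ * (if 0 < P.cap I (P.visit I x) then 1 else 0) ≤ P.cap' I (P.visit I x) := by
          split_ifs with hc
          · simpa using κ_le_cap' hc
          · simp
        rw [Nat.mul_add]
        omega
      · left; omega
  rcases key x with h1 | h1
  · refine le_trans (le_trans (Nat.mul_le_mul_left _ hx) ?_) h1
    unfold need; omega
  · have := h.le_usVisit hx.le
    rw [Nat.mul_succ]; omega

/-- Storing stops when the stream is complete, so at most one block overshoots. -/
theorem pre_M_le (h : Fits P I X) : P.pre I (P.M I) ≤ P.need I + P.B := by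
  have key : ∀ x, P.pre I x ≤ P.need I + P.B := by
    intro x
    induction x with
    | zero =>
      have : P.s * 1 ≤ P.s * P.M I := Nat.mul_le_mul_left _ h.pos
      simp only [pre, need]; omega
    | succ x ih =>
      rw [pre_succ]
      have := cap'_le (P := P) (I := I) (P.visit I x)
      unfold used
      split_ifs <;> omega
  exact key _

theorem sum_visit (h : Fits P I X) (c : ℕ → ℕ) :
    ∑ x ∈ Finset.range (P.M I), c (P.visit I x) = ∑ j ∈ Finset.range (P.M I), c j := by
  refine Finset.sum_nbij' (P.visit I) (P.time I) ?_ ?_ ?_ ?_ ?_ <;> simp only [Finset.mem_range]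
  · exact fun x _ => visit_lt h.pos x
  · exact fun j _ => time_lt h.pos j
  · exact fun x hx => time_visit h.pos hx
  · exact fun j hj => visit_time h.pos hj
  · exact fun _ _ => trivial

theorem sum_ite_first (h : Fits P I X) (c : ℕ) :
    ∑ j ∈ Finset.range (P.M I), (if j = P.first I then c else 0) = c := by
  rw [Finset.sum_ite_eq']
  simp [first_lt h.pos]

/-- The slack 4Mκ covers the unusable blocks (Mκ), statuses and code losses (M(s + g) ≤ Mκ), the
first block, which is charged in full (B ≤ Mκ), and the remainder of N modulo B (less than B ≤ Mκ).
-/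
theorem need_le_pre (h : Fits P I X) : P.need I ≤ P.pre I (P.M I) := by
  obtain ⟨h1, h2, h3, h4, h5⟩ := h.div_facts
  obtain ⟨hκ, hκ'⟩ := h.κ_facts
  have hfs := h.frz_sum_le
  have hl := h.length
  have hs := h.s_pos
  have key : ∀ x, P.need I ≤ P.pre I x ∨
      P.pre I x = P.s + ∑ y ∈ Finset.range x, P.cap' I (P.visit I y) := by
    intro x
    induction x with
    | zero => right; simp [pre]
    | succ x ih =>
      rw [pre_succ, Finset.sum_range_succ]
      by_cases hn : P.pre I x < P.need I
      · right
        have h1 : P.used I x = P.cap' I (P.visit I x) := if_pos hn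
        rw [h1]; omega
      · left; omega
  rcases key (P.M I) with h6 | h6
  · exact h6
  rw [h.sum_visit] at h6
  have hblock : ∀ j, P.B ≤ P.cap' I j + (if j = P.first I then P.B else 0) + P.frz I j +
      (P.g + P.κ) := by
    intro j
    have := h.frz_le j
    unfold cap' cap
    split_ifs <;> omega
  have hsum := Finset.sum_le_sum fun j (_ : j ∈ Finset.range (P.M I)) => hblock j
  simp only [Finset.sum_add_distrib, h.sum_ite_first, Finset.sum_const, Finset.card_range,
    smul_eq_mul] at hsum
  have e1 : P.M I * (4 * P.κ) = 4 * (P.M I * P.κ) := by ring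
  have e2 : P.M I * P.g + P.s * P.M I = P.M I * (P.s + P.g) := by ring
  have e3 : P.M I * (P.s + P.g) ≤ P.M I * P.κ := Nat.mul_le_mul_left _ hκ
  have := h.B_pos
  unfold need
  rw [← Nat.mul_add, Nat.mul_add] at hsum
  omega

/-- This is the hypothesis under which `inv` really encodes. The first block needs `κ_le_cap_first`,
since κ is imposed on it. -/
theorem used_spec (h : Fits P I X) {j : ℕ} (hj : j < P.M I) (hu : P.used I (P.time I j) ≠ 0) :
    P.used I (P.time I j) + P.g + P.frz I j ≤ P.B := by
  have h1 := h.κ_le_cap_first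
  have h2 := h.s_pos
  have h3 := h.κ_facts
  have h4 := h.frz_le j
  have hc : P.used I (P.time I j) = P.cap' I j := by
    unfold used at hu ⊢
    split_ifs at hu ⊢ with hc
    · rw [visit_time h.pos hj]
    · exact absurd rfl hu
  rw [hc] at hu ⊢
  unfold cap' at hu ⊢
  split_ifs at hu ⊢ with hf
  · subst hf
    unfold cap at h1
    split_ifs at h1 <;> omega
  · unfold cap at hu ⊢
    split_ifs at hu ⊢ <;> omega

theorem pre_eq_sum (x : ℕ) : P.pre I x = P.s + ∑ y ∈ Finset.range x, P.used I y := by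
  induction x with
  | zero => simp [pre]
  | succ x ih => rw [pre_succ, ih, Finset.sum_range_succ, add_assoc]

/-- At most `need` + B bits are stored, and the unusable blocks are themselves spare. After statuses
and code losses (at most Mκ) and three boundary terms B ≤ M, more than M of the slack 4Mκ remains,
as κ ≥ 8. -/
theorem le_spareCount (h : Fits P I X) : P.M I ≤ P.spareCount I (P.M I * P.B) := by
  obtain ⟨h1, h2, h3, h4, h5⟩ := h.div_facts
  obtain ⟨hκ, hκ'⟩ := h.κ_facts
  have hfs := h.frz_sum_le
  have hl := h.length
  have hs := h.s_pos
  have hpre := h.pre_M_le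
  rw [pre_eq_sum] at hpre
  have hused : ∑ j ∈ Finset.range (P.M I), P.used I (P.time I j) =
      ∑ x ∈ Finset.range (P.M I), P.used I x := by
    rw [← h.sum_visit]
    exact Finset.sum_congr rfl fun x hx => by rw [time_visit h.pos (Finset.mem_range.mp hx)]
  have hblock : ∀ j ∈ Finset.range (P.M I), P.B ≤
      (∑ q ∈ Finset.range P.B, P.spare I (j * P.B + q)) + P.frz I j + P.used I (P.time I j) +
        (if j = P.first I then P.B else 0) + P.g := by
    intro j hj
    have hjM := Finset.mem_range.mp hj
    by_cases hf : j = P.first I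
    · rw [if_pos hf]; omega
    by_cases hu : P.used I (P.time I j) = 0
    · have : ∑ q ∈ Finset.range P.B, P.spare I (j * P.B + q) + P.frz I j = P.B := by
        unfold frz
        rw [← Finset.sum_add_distrib]
        calc _ = ∑ q ∈ Finset.range P.B, 1 := by
              refine Finset.sum_congr rfl fun q hq => ?_
              have hq' := Finset.mem_range.mp hq
              have hdiv : (j * P.B + q) / P.B = j := by
                rw [mul_comm, Nat.mul_add_div h.B_pos, Nat.div_eq_of_lt hq', Nat.add_zero]
              have := h.fr_block j q
              unfold spare
              rw [hdiv, hu, show j * P.B + q + 1 = j * P.B + 1 + q by ring]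
              simp only [true_and]
              split_ifs <;> omega
          _ = P.B := by simp
      omega
    · have h6 : P.used I (P.time I j) = P.cap I j := by
        unfold used at hu ⊢
        split_ifs at hu ⊢
        · rw [visit_time h.pos hjM, cap', if_neg hf]
        · exact absurd rfl hu
      rw [h6] at hu ⊢
      unfold cap at hu ⊢
      split_ifs at hu ⊢ <;> omega
  have hsum := Finset.sum_le_sum hblock
  simp only [Finset.sum_add_distrib, h.sum_ite_first, Finset.sum_const, Finset.card_range,
    smul_eq_mul, hused] at hsum
  rw [← sum_range_mul] at hsum
  change _ ≤ P.spareCount I (P.M I * P.B) + _ + _ + _ + _ at hsum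
  have e1 : P.M I * (4 * P.κ) = 4 * (P.M I * P.κ) := by ring
  have e2 : P.M I * P.g + P.s * P.M I = P.M I * (P.s + P.g) := by ring
  have e3 : P.M I * (P.s + P.g) ≤ P.M I * P.κ := Nat.mul_le_mul_left _ hκ
  have e4 : P.M I * 8 ≤ P.M I * P.κ := Nat.mul_le_mul_left _ (by omega)
  have e5 := h.large
  have := h.B_pos
  unfold need at hpre
  omega

/-! ### Adjusting the weight, and consistency with the frozen positions. -/

theorem sum_flip (n : ℕ) :
    ∑ p ∈ Finset.range n, P.flip I p = min (P.spareCount I n) (P.deficit I) := by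
  induction n with
  | zero => simp [spareCount]
  | succ n ih =>
    have hs : P.spare I n ≤ 1 := by unfold spare; split_ifs <;> omega
    rw [Finset.sum_range_succ, ih, spareCount_succ, flip]
    split_ifs <;> omega

/-- The deficit is below M, so there are enough spare positions to add it in full. -/
theorem start_encode (h : Fits P I X) : P.start (P.encode I) I.N = P.first I := by
  have hf := first_lt h.pos
  have h1 : ∑ p ∈ Finset.range I.N, P.encode I (p + 1) =
      ∑ p ∈ Finset.range I.N, P.written I (P.M I) (p + 1) + P.deficit I := by
    unfold encode adjusted
    rw [Finset.sum_add_distrib]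
    congr 1
    have h2 : ∀ p, (if 1 ≤ p + 1 ∧ p + 1 ≤ P.M I * P.B then P.flip I (p + 1 - 1) else 0) =
        if p ∈ Finset.range (P.M I * P.B) then P.flip I p else 0 := by
      intro p
      have : (1 ≤ p + 1 ∧ p + 1 ≤ P.M I * P.B) ↔ p ∈ Finset.range (P.M I * P.B) := by
        rw [Finset.mem_range]; omega
      simp only [this, Nat.add_sub_cancel]
    simp only [h2]
    rw [Finset.sum_ite_mem, Finset.inter_eq_right.mpr
      (Finset.range_subset_range.mpr h.div_facts.2.2.1), sum_flip]
    have h3 := h.le_spareCount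
    have h4 : P.deficit I < P.M I := Nat.mod_lt _ h.pos
    omega
  have hW := Nat.mod_lt (∑ p ∈ Finset.range I.N, P.written I (P.M I) (p + 1)) h.pos
  unfold start
  rw [h1]
  change _ % P.M I = _
  unfold deficit
  rw [Nat.add_mod_mod, ← Nat.mod_add_mod,
    show ∀ a b c : ℕ, a < c → a + (b + c - a) = b + c from fun a b c _ => by omega]
  · rw [Nat.add_mod_right, Nat.mod_eq_of_lt hf]
  · exact hW

theorem encode_block (h : Fits P I X) {j p : ℕ} (hj : j < P.M I) (hp : p < P.B) :
    P.encode I (j * P.B + 1 + p) = P.content I j / 2 ^ p % 2 + P.flip I (j * P.B + p) := by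
  have h1 : (j + 1) * P.B ≤ P.M I * P.B := Nat.mul_le_mul_right _ hj
  rw [Nat.succ_mul] at h1
  rw [encode, adjusted, if_pos (by omega), written, (pos_block j hp).1, (pos_block j hp).2,
    if_pos ⟨by omega, hj, time_lt h.pos j⟩]
  congr 2; omega

theorem spare_block (h : Fits P I X) {j p : ℕ} (hp : p < P.B) :
    P.spare I (j * P.B + p) =
      if P.used I (P.time I j) = 0 ∧ I.fr (j * P.B + 1 + p) = 0 then 1 else 0 := by
  unfold spare
  rw [mul_comm, Nat.mul_add_div h.B_pos, Nat.div_eq_of_lt hp, Nat.add_zero,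
    show P.B * j + p + 1 = P.B * j + 1 + p by ring]

theorem flip_block (h : Fits P I X) {j p : ℕ} (hp : p < P.B)
    (hn : ¬(P.used I (P.time I j) = 0 ∧ I.fr (j * P.B + 1 + p) = 0)) :
    P.flip I (j * P.B + p) = 0 := by
  rw [flip, h.spare_block hp, if_neg hn]; simp

/-- A one is added only at free positions of blocks that store nothing, and `inv` puts zeros there.
-/
theorem encode_lt (h : Fits P I X) (p : ℕ) : P.encode I (p + 1) < 2 := by
  by_cases hp : p < P.M I * P.B
  · have hj : p / P.B < P.M I := Nat.div_lt_of_lt_mul (by rwa [mul_comm])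
    have hm := Nat.mod_lt p h.B_pos
    have he : p + 1 = p / P.B * P.B + 1 + p % P.B := by
      have := Nat.div_add_mod p P.B; rw [mul_comm]; omega
    rw [he, h.encode_block hj hm]
    by_cases hn : P.used I (P.time I (p / P.B)) = 0 ∧ I.fr (p / P.B * P.B + 1 + p % P.B) = 0
    · rw [(h.content_spec _).2.2.1 hn.1 _ hm hn.2]
      unfold flip; split_ifs <;> omega
    · rw [h.flip_block hm hn]; omega
  · rw [encode, adjusted, if_neg (by omega)]
    exact h.written_lt _ _

theorem encode_frozen (h : Fits P I X) (p : ℕ) (hp : I.fr (p + 1) = 1) : P.encode I (p + 1) = I.w (p + 1) := by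
  by_cases hp' : p < P.M I * P.B
  · have hj : p / P.B < P.M I := Nat.div_lt_of_lt_mul (by rwa [mul_comm])
    have hm := Nat.mod_lt p h.B_pos
    have he : p + 1 = p / P.B * P.B + 1 + p % P.B := by
      have := Nat.div_add_mod p P.B; rw [mul_comm]; omega
    rw [he] at hp ⊢
    rw [h.encode_block hj hm, (h.content_spec _).2.1 _ hm hp, h.flip_block hm (by omega)]
    rfl
  · rw [encode, adjusted, if_neg (by omega), written, if_neg]
    · rfl
    · rintro ⟨-, h1, -⟩
      rw [Nat.add_sub_cancel, Nat.div_lt_iff_lt_mul h.B_pos] at h1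
      omega

theorem encode_zero (h : Fits P I X) : P.encode I 0 = I.N := by
  simp [encode, adjusted, written_zero, h.w_zero]

/-! ### Decoding the encoded word. -/

theorem f_block (h : Fits P I X) {x : ℕ} (hx : x < P.M I) :
    P.f (P.used I x) (P.blk (P.encode I) (P.visit I x)) =
      num (fun i => P.strm I (P.pre I x + i)) P.B % 2 ^ P.used I x := by
  by_cases hu : P.used I x = 0
  · have := P.f_lt 0 (P.blk (P.encode I) (P.visit I x))
    rw [hu]; omega
  have hv := visit_lt h.pos x
  have ht := time_visit h.pos hx
  have hb : P.blk (P.encode I) (P.visit I x) = P.content I (P.visit I x) := by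
    have h1 := (h.content_spec (P.visit I x)).1
    have h2 := num_digits (P.content I (P.visit I x)) P.B
    rw [Nat.mod_eq_of_lt h1] at h2
    rw [← h2]
    refine num_congr fun p hp => ?_
    rw [h.encode_block hv hp, h.flip_block hp (by rw [ht]; tauto), Nat.add_zero]
  have h3 := (h.content_spec (P.visit I x)).2.2.2 (h.used_spec hv (by rwa [ht]))
  rw [ht] at h3
  rw [hb, h3]

theorem f_digit (h : Fits P I X) {x : ℕ} (hx : x < P.M I) (b : ℕ) :
    P.f (P.used I x) (P.blk (P.encode I) (P.visit I x)) / 2 ^ b % 2 =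
      if b < P.used I x then P.strm I (P.pre I x + b) else 0 := by
  have hu := used_le (P := P) (I := I) x
  split_ifs with hb
  · rw [h.f_block hx, ← num_digits, num_digit (fun i _ => by omega) hb,
      num_digit (fun i _ => h.strm_lt _) (by omega)]
  · have h1 := P.f_lt (P.used I x) (P.blk (P.encode I) (P.visit I x))
    have h2 : 2 ^ P.used I x ≤ 2 ^ b := Nat.pow_le_pow_right (by omega) (by omega)
    rw [Nat.div_eq_of_lt (by omega)]

/-- After x blocks the decoder holds exactly the first `pre` x bits of the encoder's stream. In the
induction step `le_pre` ensures that the next status is among them, so the right k is used. Of the B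
bits then written, those beyond k are zero and do no harm. -/
theorem stream_encode (h : Fits P I X) {x : ℕ} (hx : x ≤ P.M I) :
    P.stream (P.encode I) (P.M I) (P.first I) x =
      (fun i => if i < P.pre I x then P.strm I i else 0, P.pre I x) := by
  have hM : P.s * 1 ≤ P.s * P.M I := Nat.mul_le_mul_left _ h.pos
  induction x with
  | zero =>
    have hu : P.used I 0 = P.κ := by
      rw [used, if_pos, h.visit_zero, cap', if_pos rfl]
      simp only [pre, need]; omega
    have h0 : P.pre I 0 = P.s := rfl
    rw [h0, stream]
    refine Prod.ext ?_ rfl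
    funext i
    change putBits 0 0 P.κ P.s i = if i < P.s then P.strm I i else 0
    unfold putBits strm
    by_cases hi : i < P.s
    · rw [if_pos (by omega), if_pos hi, if_pos (by omega), Nat.div_eq_of_lt hi,
        Nat.mod_eq_of_lt hi, hu, Nat.sub_zero]
    · rw [if_neg (by omega), if_neg hi]; rfl
  | succ x ih =>
    have hle := h.le_pre hx
    have hu := used_le (P := P) (I := I) x
    have hs := P.lt_s
    rw [Nat.mul_succ] at hle
    have hxM : P.s * (x + 1) ≤ P.s * P.M I := Nat.mul_le_mul_left _ hx
    rw [Nat.mul_succ] at hxM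
    have hk : num (fun i => if P.s * x + i < P.pre I x then P.strm I (P.s * x + i) else 0) P.s =
        P.used I x := by
      rw [← Nat.mod_eq_of_lt (hu.trans_lt hs), ← num_digits]
      refine num_congr fun i hi => ?_
      rw [if_pos (by omega), strm, if_pos (by omega), Nat.mul_add_div (by omega),
        Nat.mul_add_mod, Nat.div_eq_of_lt hi, Nat.mod_eq_of_lt hi, Nat.add_zero]
    simp only [stream, ih (by omega), hk]
    rw [if_pos (by omega)]
    refine Prod.ext ?_ rfl
    funext i
    dsimp only
    rw [← visit, pre_succ]
    unfold putBits
    by_cases hi : P.pre I x ≤ i ∧ i < P.pre I x + P.B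
    · rw [if_pos hi, h.f_digit hx, Nat.add_sub_cancel' hi.1]
      by_cases hi2 : i < P.pre I x + P.used I x
      · rw [if_pos (by omega), if_pos hi2]
      · rw [if_neg (by omega), if_neg hi2]
    · rw [if_neg hi]
      beta_reduce
      by_cases hi2 : i < P.pre I x
      · rw [if_pos hi2, if_pos (by omega)]
      · rw [if_neg hi2, if_neg (by omega)]

theorem decode_encode (h : Fits P I X) : P.decode (P.encode I) I.N =
    (List.range (I.msg 0)).map fun i => decide (I.msg (i + 1) ≠ 0) := by
  have hS : P.decStream (P.encode I) I.N =
      (fun i => if i < P.pre I (P.M I) then P.strm I i else 0, P.pre I (P.M I)) := by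
    rw [decStream, h.start_encode]
    exact h.stream_encode le_rfl
  have hn := h.need_le_pre
  unfold need at hn
  -- The terminator was stored by `need_le_pre`, and only zeros follow it; so its place reveals the
  -- length of the message.
  have hone : lastOne (fun i => if i < P.pre I (P.M I) then P.strm I i else 0) (P.pre I (P.M I)) =
      P.s * P.M I + I.msg 0 + 1 := by
    refine lastOne_eq ?_ (by omega) fun i h1 h2 => ?_
    · rw [if_pos (by omega), strm, if_neg (by omega), if_neg (by omega), if_pos rfl]; omega
    · rw [if_pos h2, strm, if_neg (by omega), if_neg (by omega), if_neg (by omega)]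
  have hl := h.length
  have hf := h.frozen
  have hlen : P.decLen (P.encode I) I.N = I.msg 0 := by
    unfold decLen
    -- At least one position is frozen, so the length is strictly below N − N / E and passes the
    -- test in `decLen`.
    rw [hS]
    simp only [hone]
    change (if P.s * P.M I + I.msg 0 + 1 - 1 - P.s * P.M I < _ then
      P.s * P.M I + I.msg 0 + 1 - 1 - P.s * P.M I else 0) = _
    rw [if_pos (by omega)]; omega
  unfold decode
  rw [hlen, hS]
  refine List.map_congr_left fun i hi => ?_
  have hi := List.mem_range.mp hi
  change decide ((if P.s * P.M I + i < _ then P.strm I (P.s * P.M I + i) else 0) ≠ 0) = _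
  rw [if_pos (by omega), strm, if_neg (by omega), if_pos (by omega), Nat.add_sub_cancel_left]

end Fits

end Params

/-! ### The code -/

/-- The array that holds the string `l`: its length and then its bits. -/
def arr (l : List Bool) : ℕ → ℕ
  | 0 => l.length
  | i + 1 => (l.getD i false).toNat

theorem load_eq (xs : List (List Bool)) (a : ℕ) : load xs a = arr (xs.getD a []) := by
  funext i; cases i <;> rfl

theorem arr_nil : arr [] = fun _ => 0 := by
  funext i; cases i <;> simp [arr]

theorem arr_succ_lt (l : List Bool) (i : ℕ) : arr l (i + 1) < 2 := Bool.toNat_lt _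

theorem arr_ofFn {N : ℕ} (v : Fin N → Bool) {p : ℕ} (hp : p < N) :
    arr (List.ofFn v) (p + 1) = (v ⟨p, hp⟩).toNat := by
  simp [arr, hp]

theorem arr_of_le (l : List Bool) {p : ℕ} (hp : l.length ≤ p) : arr l (p + 1) = 0 := by
  simp [arr, hp]

theorem bdd_load {xs : List (List Bool)} {X : ℕ} (hX : 2 ≤ X) (h : ∀ l ∈ xs, l.length ≤ X) :
    Bdd X (load xs) := by
  intro a i
  rw [load_eq]
  cases i with
  | zero =>
    by_cases ha : a < xs.length
    · rw [List.getD_eq_getElem _ _ ha]; exact h _ (List.getElem_mem ha)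
    · rw [List.getD_eq_default _ _ (by omega)]; simp [arr]
  | succ i => exact (arr_succ_lt _ i).le.trans hX

theorem Tr.outputsWithin {X n : ℕ} {p : Cmd} {xs : List (List Bool)} {y : List Bool} {T : ℝ}
    {Q : Mem → Prop} (h : Tr X p (load xs) n Q) (hb : Bdd X (load xs))
    (hT : ((n * (p.wt * unit X) : ℕ) : ℝ) ≤ T) (hQ : ∀ τ, Q τ → output τ = y) :
    OutputsWithin p xs y T := by
  obtain ⟨S, τ, h1, h2, -, h4⟩ := h hb
  exact ⟨S, τ, h1, le_trans (by exact_mod_cast h2) hT, hQ τ h4⟩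

namespace Params

variable (P : Params)

theorem B_pos {P : Params} (hs : 0 < P.s) : 0 < P.B := by
  have h1 := P.two_le_E
  have h2 := P.le_κ
  have h3 : 0 < 4 * P.E * P.s := by positivity
  rw [P.B_eq]
  have : 0 < P.κ := by omega
  positivity

/-- A message that can be stored when the positions in `F` are frozen. -/
def Admissible (N : ℕ) (F : Finset (Fin N)) (m : List Bool) : Prop :=
  1 ≤ F.card ∧ F.card ≤ N - N / P.E ∧ m.length = N - N / P.E - F.card

variable {P}

theorem encoder_correct (hs : 0 < P.s) {N : ℕ} (hN : P.B * P.B ≤ N) {v : Word N}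
    {F : Finset (Fin N)} {m : List Bool} (hm : P.Admissible N F m) {T : ℝ}
    (hT : ((P.encSteps N * (P.encoder.wt * unit (P.bound N)) : ℕ) : ℝ) ≤ T) :
    ∃ w : Word N, (∀ u : Word 0, OutputsWithin P.encoder
        [List.ofFn v, List.ofFn (fun j : Fin N => decide (j ∈ F)), m, List.ofFn u]
        (List.ofFn w) T) ∧
      (∀ j ∈ F, w j = v j) ∧ P.decode (arr (List.ofFn w)) N = m := by
  obtain ⟨hF, hF', hlen⟩ := hm
  set I : Input := ⟨N, arr (List.ofFn v), arr (List.ofFn fun j : Fin N => decide (j ∈ F)), arr m⟩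
    with hI
  have hB := B_pos hs
  have hM : P.B ≤ P.M I := (Nat.le_div_iff_mul_le hB).mpr hN
  have hsum : ∑ p ∈ Finset.range N, I.fr (p + 1) = F.card := by
    rw [Finset.sum_range]
    simp only [hI, arr_ofFn _ (Fin.isLt _), Fin.eta]
    rw [Finset.card_eq_sum_ones, ← Finset.sum_filter_add_sum_filter_not Finset.univ (· ∈ F)]
    have h1 : ∀ j ∈ Finset.univ.filter (· ∈ F), (decide (j ∈ F)).toNat = 1 := by simp
    have h2 : ∀ j ∈ Finset.univ.filter (¬ · ∈ F), (decide (j ∈ F)).toNat = 0 := by simp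
    rw [Finset.sum_congr rfl h1, Finset.sum_congr rfl h2]
    simp
  have hK : m.length + F.card = N - N / P.E := by rw [hlen, Nat.sub_add_cancel hF']
  have hmN : m.length ≤ N := hlen ▸ (Nat.sub_le _ _).trans (Nat.sub_le _ _)
  have hfit : Fits P I (P.bound N) :=
    { bound := le_rfl
      pos := hB.trans_le hM
      w_zero := by simp [hI, arr]
      w_lt := fun p => arr_succ_lt _ p
      fr_lt := fun p => arr_succ_lt _ p
      msg_lt := fun p => arr_succ_lt _ p
      msg_le := hmN
      s_pos := hs
      large := hM
      length := by
        change m.length + ∑ p ∈ Finset.range N, I.fr (p + 1) = N - N / P.E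
        rw [hsum]; exact hK
      frozen := by
        change 0 < ∑ p ∈ Finset.range N, I.fr (p + 1)
        rw [hsum]; exact hF }
  set w : Word N := fun j => decide (P.encode I (j + 1) ≠ 0) with hw
  have hwarr : arr (List.ofFn w) = P.encode I := by
    funext p
    cases p with
    | zero => rw [hfit.encode_zero]; simp [arr, hI]
    | succ p =>
      by_cases hp : p < N
      · rw [arr_ofFn _ hp]
        have := hfit.encode_lt p
        simp only [hw]
        interval_cases h : P.encode I (p + 1) <;> rfl
      · have h1 : P.M I * P.B ≤ N := Nat.div_mul_le_self _ _
        have h2 : arr (List.ofFn v) (p + 1) = 0 := arr_of_le _ (by simpa using hp)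
        rw [arr_of_le _ (by simpa using hp), encode, adjusted, if_neg (by omega), written, if_neg]
        · exact h2.symm
        · rintro ⟨-, h3, -⟩
          rw [Nat.add_sub_cancel, Nat.div_lt_iff_lt_mul hB] at h3
          omega
  refine ⟨w, fun u => ?_, fun j hj => ?_, ?_⟩
  · refine (Tr_encoder (I := I) hfit.toOk (by rw [load_eq]; rfl) (by rw [load_eq]; rfl)
      (by rw [load_eq]; rfl) fun a ha => ?_).outputsWithin (bdd_load ?_ ?_) hT fun τ hτ => ?_
    · rw [load_eq, List.getD_eq_default _ _ (by simpa using ha), arr_nil]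
    · exact (bound_facts (P := P) (N := N) le_rfl).1
    · have := (bound_facts (P := P) (N := N) le_rfl).2.1
      simp only [List.mem_cons, List.not_mem_nil, or_false]
      rintro l (rfl | rfl | rfl | rfl) <;> (try rw [List.length_ofFn]) <;> omega
    · unfold output
      rw [hτ, hfit.encode_zero]
      refine List.ext_getElem (by simp [hI]) fun i h1 h2 => ?_
      simp [hw]
  · have h1 := hfit.encode_frozen j (by
      change arr (List.ofFn fun j : Fin N => decide (j ∈ F)) (↑j + 1) = 1
      rw [arr_ofFn _ j.isLt]; simp [hj])
    rw [← hwarr] at h1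
    change arr (List.ofFn w) (↑j + 1) = arr (List.ofFn v) (↑j + 1) at h1
    rw [arr_ofFn _ j.isLt, arr_ofFn _ j.isLt] at h1
    revert h1
    cases w j <;> cases v j <;> simp
  · rw [hwarr, hfit.decode_encode]
    refine List.ext_getElem (by simp [hI, arr]) fun i h1 h2 => ?_
    simp [hI, arr, h2]

theorem decoder_runs (hs : 0 < P.s) {N : ℕ} (hN : P.B * P.B ≤ N) (w : Word N) {T : ℝ}
    (hT : ((P.decSteps N * (P.decoder.wt * unit (P.bound N)) : ℕ) : ℝ) ≤ T) :
    OutputsWithin P.decoder [List.ofFn w] (P.decode (arr (List.ofFn w)) N) T := by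
  have hB := B_pos hs
  have hf := bound_facts (P := P) (N := N) le_rfl
  have h0 : load [List.ofFn w] 0 = arr (List.ofFn w) := load_eq _ _
  refine (Tr_decoder (P := P) (X := P.bound N) (N := N) le_rfl (by simp [h0, arr]) (fun a ha => ?_)
    (fun p => ?_) (hB.trans_le ((Nat.le_div_iff_mul_le hB).mpr hN))).outputsWithin
    (bdd_load hf.1 (by simp; omega)) hT fun τ hτ => by rw [hτ, h0]
  · rw [load_eq, List.getD_eq_default _ _ (by simp; omega), arr_nil]
  · rw [h0]; exact arr_succ_lt _ p

/-- The message sets. -/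
def msgSet (P : Params) (N i : ℕ) : Finset (List Bool) :=
  if i ≤ N - N / P.E then
    Finset.univ.image (List.ofFn : (Fin (N - N / P.E - i) → Bool) → List Bool)
  else ∅

theorem mem_msgSet {N i : ℕ} {m : List Bool} :
    m ∈ P.msgSet N i ↔ i ≤ N - N / P.E ∧ m.length = N - N / P.E - i := by
  unfold msgSet
  split_ifs with h
  · simp only [Finset.mem_image, Finset.mem_univ, true_and, h]
    constructor
    · rintro ⟨x, rfl⟩; simp
    · intro hm
      exact ⟨fun j => m[j]'(by omega), by
        refine List.ext_getElem (by simp [hm]) fun i h1 h2 => by simp⟩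
  · simp [h]

theorem card_msgSet {N i : ℕ} (h : i ≤ N - N / P.E) :
    (P.msgSet N i).card = 2 ^ (N - N / P.E - i) := by
  rw [msgSet, if_pos h, Finset.card_image_of_injective _ List.ofFn_injective]
  simp

/-- The test in `decLen` serves this purpose: a decoded length below N − N / E belongs to some i ≥
1, even for words that no encoder produces. -/
theorem decode_mem (w : ℕ → ℕ) {N : ℕ} (hN : 0 < N) :
    ∃ i ∈ Finset.Icc 1 N, P.decode w N ∈ P.msgSet N i := by
  have h1 : N / P.E < N := Nat.div_lt_self hN P.two_le_E
  have h2 : P.decLen w N < N - N / P.E := by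
    unfold decLen
    dsimp only
    split_ifs with h
    · exact h
    · omega
  refine ⟨N - N / P.E - P.decLen w N, ?_, ?_⟩
  · rw [Finset.mem_Icc]
    have : N - N / P.E ≤ N := Nat.sub_le _ _
    omega
  · rw [mem_msgSet]
    simp only [decode, List.length_map, List.length_range]
    omega

/-- Near-linear bounds with a constant are below `N log³ N` for large `N`. -/
theorem time_le (P : Params) (C D : ℕ) : ∃ N₀ : ℕ, ∀ N, N₀ < N →
    ((C * (N + 1) * (D * unit (P.bound N)) : ℕ) : ℝ) ≤ N * Real.logb 2 N ^ 3 := by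
  set b := P.B + P.s
  -- Numbers have at most about 2 log N bits, so the cost is at most C·2N·D·(2 log N)²; beyond this
  -- N₀ the factor 8CD is at most log N.
  refine ⟨2 ^ (8 * C * D + b + 3) + 2, fun N hN => ?_⟩
  have hN2 : 2 < N := by have : 0 < 2 ^ (8 * C * D + b + 3) := by positivity
                         omega
  have hN0 : (0 : ℝ) < N := by positivity
  set l := Real.logb 2 N
  have hl : ((8 * C * D + b + 3 : ℕ) : ℝ) ≤ l := by
    rw [Real.le_logb_iff_rpow_le (by norm_num) hN0, Real.rpow_natCast]
    exact_mod_cast (by omega : 2 ^ (8 * C * D + b + 3) ≤ N)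
  push_cast at hl
  have hz : ((P.bound N).size : ℝ) + 1 ≤ 2 * l := by
    have hpos : 0 < (P.bound N).size := Nat.size_pos.mpr (by unfold bound; positivity)
    obtain ⟨z, hz⟩ := Nat.exists_eq_succ_of_ne_zero hpos.ne'
    have h1 : 2 ^ z ≤ P.bound N := Nat.lt_size.mp (by omega)
    have h2 : P.bound N ≤ N * 2 ^ (b + 1) := by
      unfold bound
      rw [pow_succ]
      nlinarith [Nat.zero_le (2 ^ b)]
    have h3 : ((2 : ℝ)) ^ z ≤ N * 2 ^ (b + 1) := by exact_mod_cast h1.trans h2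
    have h4 := Real.logb_le_logb_of_le (b := 2) (by norm_num) (by positivity) h3
    rw [Real.logb_mul hN0.ne' (by positivity), Real.logb_pow, Real.logb_pow,
      Real.logb_self_eq_one (by norm_num)] at h4
    rw [hz]
    push_cast at h4 ⊢
    have : (0 : ℝ) ≤ C * D := by positivity
    have : (0 : ℝ) ≤ b := by positivity
    linarith
  have hl0 : 0 ≤ l := by
    have : (0 : ℝ) ≤ 8 * C * D + b + 3 := by positivity
    linarith
  unfold unit
  push_cast
  calc (C : ℝ) * (N + 1) * (D * ((P.bound N).size + 1) ^ 2)
      ≤ C * (2 * N) * (D * (2 * l) ^ 2) := by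
        gcongr
        have : (2 : ℝ) < N := by exact_mod_cast hN2
        linarith
    _ = N * ((8 * C * D) * l ^ 2) := by ring
    _ ≤ N * (l * l ^ 2) := by
        gcongr
        have : (0 : ℝ) ≤ b := by positivity
        linarith
    _ = N * l ^ 3 := by ring

theorem encSteps_le (N : ℕ) : P.encSteps N ≤ (P.s + P.B + 60) * (N + 1) := by
  unfold encSteps
  nlinarith [Nat.zero_le (N * P.s), Nat.zero_le (N * P.B)]

theorem decSteps_le (N : ℕ) :
    P.decSteps N ≤ (P.B + 33 + 4 * P.s + 3 * 2 ^ P.s) * (N + 1) := by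
  unfold decSteps
  nlinarith [Nat.zero_le (N * P.s), Nat.zero_le (N * P.B), Nat.zero_le (2 ^ P.s)]

open Classical in
/-- The code; its encoder uses no random bits and never fails on admissible inputs. -/
noncomputable def code (P : Params) (N : ℕ)
    (w : ∀ (_ : Word N) (F : Finset (Fin N)) (m : List Bool), P.Admissible N F m → Word N) :
    RandCode N 0 where
  msgs := P.msgSet N
  enc v F m _ := if h : P.Admissible N F m then some (w v F m h) else none
  dec x := P.decode (arr (List.ofFn x)) N

end Params

end StuckAt

/-! ### The theorem. -/

theorem theorem2 :
    ∃ (c : ℝ) (a b : ℕ) (δ : ℕ → ℝ), Filter.Tendsto δ Filter.atTop (nhds 0) ∧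
      ∀ ε : ℝ, 0 < ε →
        ∃ (encoder decoder : StuckAt.Cmd) (N₀ : ℕ), ∀ N : ℕ, N₀ < N →
          ∃ (t : ℕ) (K : StuckAt.RandCode N t),
            K.IsStrongStuckAt ∧ K.HasBinaryMessages ∧ K.IsGapped ε ∧
            K.EncoderRunsIn encoder (c * (N * Real.logb 2 N ^ a * (1 / ε) ^ b)) ∧
            K.DecoderRunsIn decoder (c * (N * Real.logb 2 N ^ a * (1 / ε) ^ b)) ∧
            (t : ℝ) ≤ c * (1 / ε * Real.logb 2 N) ∧
            K.SucceedsWithProb (1 - δ N) := by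
  open StuckAt in
  -- The exponent of 1/ε may be 0, because N₀ depends on ε and the third logarithm absorbs every
  -- constant. The failure probability is 0.
  refine ⟨1, 3, 0, fun _ => 0, tendsto_const_nhds, fun ε hε => ?_⟩
  -- The added 1 secures E ≥ 2 also for large ε.
  obtain ⟨P, hPE, hs⟩ := exists_params (E := ⌈1 / ε⌉₊ + 1) (by
    have : 0 < ⌈1 / ε⌉₊ := Nat.ceil_pos.mpr (by positivity)
    omega)
  have hE : 1 ≤ ε * P.E := by
    have h1 : 1 / ε ≤ P.E := by
      rw [hPE]; push_cast
      have := Nat.le_ceil (1 / ε)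
      linarith
    rwa [div_le_iff₀' hε] at h1
  obtain ⟨N₁, hN₁⟩ := P.time_le (P.s + P.B + 60) P.encoder.wt
  obtain ⟨N₂, hN₂⟩ := P.time_le (P.B + 33 + 4 * P.s + 3 * 2 ^ P.s) P.decoder.wt
  -- The term B² ensures that there are at least B blocks.
  refine ⟨P.encoder, P.decoder, N₁ + N₂ + P.B * P.B, fun N hN => ?_⟩
  have hTe := (Nat.cast_le (α := ℝ).mpr
    (Nat.mul_le_mul_right (P.encoder.wt * unit (P.bound N)) (P.encSteps_le N))).trans
    (hN₁ N (by omega))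
  have hTd := (Nat.cast_le (α := ℝ).mpr
    (Nat.mul_le_mul_right (P.decoder.wt * unit (P.bound N)) (P.decSteps_le N))).trans
    (hN₂ N (by omega))
  choose w hw1 hw2 hw3 using fun (v : Word N) (F : Finset (Fin N)) (m : List Bool)
    (h : P.Admissible N F m) => Params.encoder_correct hs (by omega) (v := v) h hTe
  have hadm : ∀ {i : ℕ} {F : Finset (Fin N)} {m : List Bool}, i ∈ Finset.Icc 1 N → F.card = i →
      m ∈ P.msgSet N i → P.Admissible N F m := by
    rintro i F m hi rfl hm
    rw [Params.mem_msgSet] at hm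
    exact ⟨(Finset.mem_Icc.mp hi).1, hm.1, hm.2⟩
  have hN0 : (0 : ℝ) < N := by exact_mod_cast (by omega : 0 < N)
  have hdiv : ((N / P.E : ℕ) : ℝ) ≤ ε * N := by
    have hE0 : (0 : ℝ) < P.E := by
      have := P.two_le_E
      exact_mod_cast (by omega : 0 < P.E)
    refine Nat.cast_div_le.trans ?_
    rw [div_le_iff₀ hE0]
    nlinarith
  rw [pow_zero, mul_one, one_mul]
  refine ⟨0, P.code N w, ⟨?_, fun x => Params.decode_mem _ (by omega)⟩, ?_, ?_, ?_, ?_, ?_, ?_⟩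
  · intro i hi v F hF m hm u x hx
    have h := hadm hi hF hm
    simp only [Params.code, dif_pos h, Option.some.injEq] at hx
    subst hx
    exact ⟨hw2 v F m h, hw3 v F m h⟩
  · intro i _
    by_cases h : i ≤ N - N / P.E
    · exact Or.inr ⟨N - N / P.E - i, fun x => by simp [Params.code, Params.mem_msgSet, h]⟩
    · exact Or.inl (if_neg h)
  · rintro ρ ⟨hρ0, hρ1⟩ i hi
    have hle : N / P.E ≤ N := Nat.div_le_self _ _
    have h2 : (i : ℝ) + (N / P.E : ℕ) ≤ N := by
      rw [hi]; nlinarith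
    have h3 : i + N / P.E ≤ N := by exact_mod_cast h2
    have h4 : i ≤ N - N / P.E := by omega
    unfold RandCode.rate
    rw [show (P.code N w).msgs i = P.msgSet N i from rfl, Params.card_msgSet h4, Nat.cast_pow,
      Nat.cast_ofNat, Real.logb_pow, Real.logb_self_eq_one (by norm_num), mul_one,
      le_div_iff₀ hN0, Nat.cast_sub h4, Nat.cast_sub hle, hi]
    nlinarith
  · intro i hi v F hF m hm u
    have h := hadm hi hF hm
    simp only [Params.code, dif_pos h, RandCode.resultString]
    exact hw1 v F m h u
  · exact fun x => Params.decoder_runs hs (by omega) x hTd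
  · have : 0 ≤ Real.logb 2 N :=
      Real.logb_nonneg (by norm_num) (by exact_mod_cast (by omega : 1 ≤ N))
    rw [Nat.cast_zero]
    positivity
  · intro i hi v F hF m hm
    have h := hadm hi hF hm
    simp [RandCode.successProb, Params.code, h]
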